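/- Let $k$ be a field of characteristic zero and $n\ge 0$. Let $U_n(k)$ be the group of upper triangular $n\times n$ matrices over $k$ with ones on the diagonal, and let $U$ be the group of $k$-points of a unipotent algebraic group over $k$, that is, of an algebraic subgroup of $U_n$: $U$ is a subgroup of $U_n(k)$ which is the set of common zeros in $U_n(k)$ of a family of polynomials over $k$ in the matrix entries. Let $\mathfrak u=\log(U)$ be its Lie algebra, that is, the Lie algebra of all strictly upper triangular matrices $X$ over $k$ with $\exp X=\sum_{m\ge 0}X^m/m!\in U$, let $\exp:\mathfrak u\to U$ be the exponential map, and for $u\in U$ let $\mathrm{Ad}(u)$ be the automorphism $X\mapsto uXu^{-1}$ of $\mathfrak u$, so that $\exp(\mathrm{Ad}(u)X)=u\exp(X)u^{-1}$. If $G$ is a group acting by automorphisms on a group $\Gamma$, let $\mathrm{Tr}(\Gamma,G)$ be the set of functions $\varphi:\Gamma\to\mathbf C$ such that - $\varphi$ is of positive type: $\sum_{i,j=1}^m\lambda_i\overline{\lambda_j}\,\varphi(\gamma_j^{-1}\gamma_i)\ge 0$ for all $m$, all $\lambda_1,\dots,\lambda_m\in\mathbf C$ and all $\gamma_1,\dots,\gamma_m\in\Gamma$;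 - $\varphi(g(\gamma))=\varphi(\gamma)$ for all $g\in G$ and $\gamma\in\Gamma$; - $\varphi(e)=1$. Let $\mathrm{Tr}(\Gamma)=\mathrm{Tr}(\Gamma,\Gamma)$, where $\Gamma$ acts on itself by conjugation; its elements are called traces on $\Gamma$. Let $\mathrm{Tr}(\mathfrak u,\mathrm{Ad}(U))$ be the set so defined for the additive group $\mathfrak u$, on which $U$ acts through $\mathrm{Ad}$. Then, for every function $\varphi:U\to\mathbf C$, we have $\varphi\in\mathrm{Tr}(U)$ if and only if $\varphi\circ\exp\in\mathrm{Tr}(\mathfrak u,\mathrm{Ad}(U))$. Moreover, the map $\varphi\mapsto\varphi\circ\exp$ is a bijection from $\mathrm{Tr}(U)$ onto $\mathrm{Tr}(\mathfrak u,\mathrm{Ad}(U))$. -/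

import Mathlib

namespace UnipotentTraces

/-! ### Functions of positive type and invariant traces on a group -/

/-- A function `φ : Γ → ℂ` on a group is of positive type if
`∑ i, ∑ j, λ i * conj (λ j) * φ ((γ j)⁻¹ * γ i)` is a nonnegative real number for all finite
families `λ i` of complex numbers and `γ i` of elements of `Γ`. -/
def IsPositiveType {Γ : Type*} [Group Γ] (φ : Γ → ℂ) : Prop :=
  ∀ (m : ℕ) (c : Fin m → ℂ) (γ : Fin m → Γ),
    ∃ r : ℝ, 0 ≤ r ∧
      ∑ i, ∑ j, c i * (starRingEnd ℂ) (c j) * φ ((γ j)⁻¹ * γ i) = (r : ℂ)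

/-- `Tr(Γ, G)`: the normalized functions of positive type on `Γ` that are invariant under the
group `G`, which acts on `Γ` by automorphisms through `ρ`. -/
def invariantTraces {Γ G : Type*} [Group Γ] [Group G] (ρ : G →* MulAut Γ) : Set (Γ → ℂ) :=
  {φ | IsPositiveType φ ∧ (∀ (g : G) (γ : Γ), φ (ρ g γ) = φ γ) ∧ φ 1 = 1}

/-- `Tr(Γ) = Tr(Γ, Γ)`, for the action of `Γ` on itself by conjugation. -/
def traces (Γ : Type*) [Group Γ] : Set (Γ → ℂ) :=
  invariantTraces (MulAut.conj : Γ →* MulAut Γ)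

/-! ### Unipotent algebraic groups -/

section Matrices

attribute [local instance 100] LieRing.ofAssociativeRing

variable {k : Type*} [Field k] {n : ℕ}

/-- Upper triangular matrices with ones on the diagonal. -/
def IsUpperUnitriangular (M : Matrix (Fin n) (Fin n) k) : Prop :=
  (∀ i, M i i = 1) ∧ ∀ i j, j < i → M i j = 0

/-- Strictly upper triangular matrices. -/
def IsStrictlyUpper (M : Matrix (Fin n) (Fin n) k) : Prop :=
  ∀ i j, j ≤ i → M i j = 0

/-- The value at the matrix `M` of a polynomial in the matrix entries. -/
noncomputable def evalAt (M : Matrix (Fin n) (Fin n) k) (p : MvPolynomial (Fin n × Fin n) k) : k :=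
  MvPolynomial.eval (fun ij => M ij.1 ij.2) p

/-- `U` is (the group of `k`-points of) an algebraic subgroup of the group `U_n` of upper
unitriangular matrices: a subgroup of `GL_n(k)` which is the set of all upper unitriangular
matrices that satisfy some set of polynomial equations with coefficients in `k`. -/
def IsUnipotentAlgebraic (U : Subgroup (GL (Fin n) k)) : Prop :=
  ∃ S : Set (MvPolynomial (Fin n × Fin n) k), ∀ g : GL (Fin n) k,
    g ∈ U ↔ IsUpperUnitriangular (g : Matrix (Fin n) (Fin n) k) ∧
      ∀ p ∈ S, evalAt (g : Matrix (Fin n) (Fin n) k) p = 0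

/-! #### Strictly upper triangular matrices -/

theorem IsStrictlyUpper.add {X Y : Matrix (Fin n) (Fin n) k} (hX : IsStrictlyUpper X)
    (hY : IsStrictlyUpper Y) : IsStrictlyUpper (X + Y) := by
  intro i j h
  simp [hX i j h, hY i j h]

theorem IsStrictlyUpper.smul {X : Matrix (Fin n) (Fin n) k} (c : k) (hX : IsStrictlyUpper X) :
    IsStrictlyUpper (c • X) := by
  intro i j h
  simp [hX i j h]

theorem IsStrictlyUpper.mul_left {X Y : Matrix (Fin n) (Fin n) k}
    (hX : ∀ i j, j < i → X i j = 0) (hY : IsStrictlyUpper Y) : IsStrictlyUpper (X * Y) := by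
  intro i j h
  rw [Matrix.mul_apply]
  refine Finset.sum_eq_zero fun l _ => ?_
  rcases lt_or_ge l i with hl | hl
  · rw [hX i l hl, zero_mul]
  · rw [hY l j (h.trans hl), mul_zero]

theorem IsStrictlyUpper.mul_right {X Y : Matrix (Fin n) (Fin n) k}
    (hX : IsStrictlyUpper X) (hY : ∀ i j, j < i → Y i j = 0) : IsStrictlyUpper (X * Y) := by
  intro i j h
  rw [Matrix.mul_apply]
  refine Finset.sum_eq_zero fun l _ => ?_
  rcases le_or_gt l i with hl | hl
  · rw [hX i l hl, zero_mul]
  · rw [hY l j (h.trans_lt hl), mul_zero]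

theorem IsStrictlyUpper.lie {X Y : Matrix (Fin n) (Fin n) k} (hX : IsStrictlyUpper X)
    (hY : IsStrictlyUpper Y) : IsStrictlyUpper ⁅X, Y⁆ := by
  rw [Ring.lie_def, sub_eq_add_neg, ← neg_one_smul k (Y * X)]
  exact (IsStrictlyUpper.mul_left (fun i j h => hX i j h.le) hY).add
    ((IsStrictlyUpper.mul_left (fun i j h => hY i j h.le) hX).smul (-1))

theorem IsStrictlyUpper.isNilpotent {X : Matrix (Fin n) (Fin n) k} (hX : IsStrictlyUpper X) :
    IsNilpotent X := by
  refine ⟨n, ?_⟩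
  have h1 : X.charpoly = Polynomial.X ^ n := by
    rw [Matrix.charpoly_of_isUpperTriangular X (fun i j h => hX i j (le_of_lt h))]
    simp [hX _ _ le_rfl]
  simpa [h1] using Matrix.aeval_self_charpoly X

theorem IsStrictlyUpper.isUpperUnitriangular_exp [CharZero k] {X : Matrix (Fin n) (Fin n) k}
    (hX : IsStrictlyUpper X) : IsUpperUnitriangular (IsNilpotent.exp X) := by
  obtain ⟨N, hN⟩ := hX.isNilpotent
  have hN' : X ^ (N + 1) = 0 := by rw [pow_succ, hN, zero_mul]
  have hp : ∀ m : ℕ, IsStrictlyUpper (X ^ (m + 1)) := by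
    intro m
    induction m with
    | zero => simpa using hX
    | succ m ih => rw [pow_succ]; exact IsStrictlyUpper.mul_right ih (fun i j h => hX i j h.le)
  have key : ∀ i j, j ≤ i → IsNilpotent.exp X i j = (1 : Matrix (Fin n) (Fin n) k) i j := by
    intro i j h
    rw [IsNilpotent.exp_eq_sum hN', Finset.sum_range_succ', Matrix.add_apply, Matrix.sum_apply,
      Finset.sum_eq_zero]
    · simp
    · intro m _
      rw [Matrix.smul_apply, hp m i j h, smul_zero]
  exact ⟨fun i => by rw [key i i le_rfl, Matrix.one_apply_eq],
    fun i j h => by rw [key i j h.le, Matrix.one_apply_ne h.ne']⟩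

/-! #### Left invariant derivations

The derivation `D_X` of the polynomial ring in the matrix entries, `D_X x_{ij} = ∑ l, x_{il} X_{lj}`,
is used to show that the logarithm of an algebraic subgroup of `U_n` is a Lie algebra. -/

/-- `D_X p` is the derivative of `p` along the left invariant vector field `g ↦ g X`. -/
noncomputable def leftDeriv (X : Matrix (Fin n) (Fin n) k) :
    Derivation k (MvPolynomial (Fin n × Fin n) k) (MvPolynomial (Fin n × Fin n) k) :=
  MvPolynomial.mkDerivation k fun ij => ∑ l, X l ij.2 • MvPolynomial.X (ij.1, l)

theorem leftDeriv_X (X : Matrix (Fin n) (Fin n) k) (i j : Fin n) :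
    leftDeriv X (MvPolynomial.X (i, j)) = ∑ l, X l j • MvPolynomial.X (i, l) := by
  simp [leftDeriv, MvPolynomial.mkDerivation_X]

theorem leftDeriv_add (X Y : Matrix (Fin n) (Fin n) k) :
    leftDeriv (X + Y) = leftDeriv X + leftDeriv Y := by
  refine MvPolynomial.derivation_ext fun ij => ?_
  obtain ⟨i, j⟩ := ij
  simp [leftDeriv_X, add_smul, Finset.sum_add_distrib]

theorem leftDeriv_smul (c : k) (X : Matrix (Fin n) (Fin n) k) :
    leftDeriv (c • X) = c • leftDeriv X := by
  refine MvPolynomial.derivation_ext fun ij => ?_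
  obtain ⟨i, j⟩ := ij
  simp only [leftDeriv_X, Derivation.smul_apply, Matrix.smul_apply, smul_eq_mul, mul_smul,
    Finset.smul_sum]

theorem leftDeriv_lie (X Y : Matrix (Fin n) (Fin n) k) :
    leftDeriv ⁅X, Y⁆ = ⁅leftDeriv X, leftDeriv Y⁆ := by
  refine MvPolynomial.derivation_ext fun ij => ?_
  obtain ⟨i, j⟩ := ij
  have h : ∀ A B : Matrix (Fin n) (Fin n) k,
      leftDeriv A (leftDeriv B (MvPolynomial.X (i, j))) =
        ∑ l, (A * B) l j • (MvPolynomial.X (i, l) : MvPolynomial (Fin n × Fin n) k) := by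
    intro A B
    simp only [leftDeriv_X, map_sum, Derivation.map_smul, Finset.smul_sum, smul_smul,
      Matrix.mul_apply, Finset.sum_smul]
    rw [Finset.sum_comm]
    refine Finset.sum_congr rfl fun a _ => Finset.sum_congr rfl fun b _ => ?_
    rw [mul_comm]
  rw [Derivation.commutator_apply, h, h, leftDeriv_X, Ring.lie_def]
  simp [sub_smul, Finset.sum_sub_distrib]

/-- The polynomial curve `t ↦ exp (t X)`, as a matrix of polynomials. -/
noncomputable def expCurve (X : Matrix (Fin n) (Fin n) k) (N : ℕ) :
    Matrix (Fin n) (Fin n) (Polynomial k) :=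
  fun i j => ∑ m ∈ Finset.range N, Polynomial.monomial m ((m.factorial : k)⁻¹ * (X ^ m) i j)

variable [CharZero k]

theorem eval_expCurve {X : Matrix (Fin n) (Fin n) k} {N : ℕ} (hN : X ^ N = 0) (t : k)
    (i j : Fin n) : (expCurve X N i j).eval t = IsNilpotent.exp (t • X) i j := by
  have h : (t • X) ^ N = 0 := by rw [smul_pow, hN, smul_zero]
  rw [IsNilpotent.exp_eq_sum h, Matrix.sum_apply, expCurve, Polynomial.eval_finsetSum]
  refine Finset.sum_congr rfl fun m _ => ?_
  rw [Polynomial.eval_monomial, smul_pow, Matrix.smul_apply, Matrix.smul_apply, smul_eq_mul,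
    Rat.smul_def]
  push_cast
  ring

theorem derivative_expCurve {X : Matrix (Fin n) (Fin n) k} {N : ℕ} (hN : X ^ N = 0)
    (i j : Fin n) : Polynomial.derivative (expCurve X N i j) =
      ∑ l, expCurve X N i l * Polynomial.C (X l j) := by
  cases N with
  | zero => simp [expCurve]
  | succ N =>
    have h1 : ∀ m : ℕ, ∑ l, (X ^ m) i l * X l j = (X ^ (m + 1)) i j := fun m => by
      rw [pow_succ, Matrix.mul_apply]
    simp only [expCurve, Finset.sum_mul, Polynomial.monomial_mul_C]
    rw [Finset.sum_comm]
    simp only [← map_sum, mul_assoc, ← Finset.mul_sum, h1]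
    rw [Finset.sum_range_succ', Finset.sum_range_succ, hN, map_add, map_sum]
    simp only [Polynomial.derivative_monomial]
    simp only [Nat.add_sub_cancel, Nat.cast_zero, mul_zero, Matrix.zero_apply, map_zero, add_zero]
    refine Finset.sum_congr rfl fun m _ => ?_
    congr 1
    rw [Nat.factorial_succ]
    have h2 : ((m + 1 : ℕ) : k) ≠ 0 := Nat.cast_ne_zero.mpr m.succ_ne_zero
    have h3 : (m.factorial : k) ≠ 0 := Nat.cast_ne_zero.mpr m.factorial_ne_zero
    push_cast at h2 ⊢
    field_simp

/-- The polynomial function `t ↦ p (g exp (t X))`. -/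
noncomputable def alongCurve (g X : Matrix (Fin n) (Fin n) k) (N : ℕ) :
    MvPolynomial (Fin n × Fin n) k →ₐ[k] Polynomial k :=
  MvPolynomial.aeval fun ij => ∑ l, Polynomial.C (g ij.1 l) * expCurve X N l ij.2

theorem eval_alongCurve (g : Matrix (Fin n) (Fin n) k) {X : Matrix (Fin n) (Fin n) k} {N : ℕ}
    (hN : X ^ N = 0) (t : k) (p : MvPolynomial (Fin n × Fin n) k) :
    (alongCurve g X N p).eval t = evalAt (g * IsNilpotent.exp (t • X)) p := by
  induction p using MvPolynomial.induction_on with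
  | C a => simp [alongCurve, evalAt]
  | add p q hp hq => rw [map_add, Polynomial.eval_add, hp, hq, evalAt, evalAt, evalAt, map_add]
  | mul_X p ij hp =>
    rw [map_mul, Polynomial.eval_mul, hp, evalAt, evalAt, map_mul]
    simp [alongCurve, Polynomial.eval_finsetSum, eval_expCurve hN, Matrix.mul_apply]

theorem derivative_alongCurve (g : Matrix (Fin n) (Fin n) k) {X : Matrix (Fin n) (Fin n) k}
    {N : ℕ} (hN : X ^ N = 0) (p : MvPolynomial (Fin n × Fin n) k) :
    Polynomial.derivative (alongCurve g X N p) = alongCurve g X N (leftDeriv X p) := by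
  induction p using MvPolynomial.induction_on with
  | C a =>
    rw [← MvPolynomial.algebraMap_eq, Derivation.map_algebraMap, map_zero, AlgHom.commutes,
      ← Polynomial.C_eq_algebraMap, Polynomial.derivative_C]
  | add p q hp hq => simp only [map_add, hp, hq]
  | mul_X p ij hp =>
    obtain ⟨i, j⟩ := ij
    have hX : Polynomial.derivative (alongCurve g X N (MvPolynomial.X (i, j))) =
        alongCurve g X N (leftDeriv X (MvPolynomial.X (i, j))) := by
      simp only [leftDeriv_X, map_sum, map_smul]
      simp only [alongCurve, MvPolynomial.aeval_X, map_sum, Polynomial.derivative_C_mul,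
        derivative_expCurve hN, Finset.mul_sum, Finset.smul_sum, Polynomial.smul_eq_C_mul]
      rw [Finset.sum_comm]
      refine Finset.sum_congr rfl fun a _ => Finset.sum_congr rfl fun b _ => ?_
      ring
    rw [map_mul, Polynomial.derivative_mul, hp, hX, Derivation.leibniz, map_add, smul_eq_mul,
      smul_eq_mul, map_mul, map_mul]
    ring

/-! #### The Lie algebra of a unipotent algebraic group -/

/-- `𝔲 = log(U)` as a set: the strictly upper triangular matrices `X` with `exp X ∈ U`. -/
def logSet (U : Subgroup (GL (Fin n) k)) : Set (Matrix (Fin n) (Fin n) k) :=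
  {X | IsStrictlyUpper X ∧
    ∃ g ∈ U, (g : Matrix (Fin n) (Fin n) k) = IsNilpotent.exp X}

/-- The polynomials in the matrix entries that vanish on `U`. -/
def VanishesOn (U : Subgroup (GL (Fin n) k)) (p : MvPolynomial (Fin n × Fin n) k) : Prop :=
  ∀ g ∈ U, evalAt (g : Matrix (Fin n) (Fin n) k) p = 0

theorem mem_logSet_iff {U : Subgroup (GL (Fin n) k)} (hU : IsUnipotentAlgebraic U)
    (X : Matrix (Fin n) (Fin n) k) :
    X ∈ logSet U ↔ IsStrictlyUpper X ∧ ∀ p, VanishesOn U p → VanishesOn U (leftDeriv X p) := by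
  refine and_congr_right fun hX => ?_
  obtain ⟨N, hN⟩ := hX.isNilpotent
  constructor
  · rintro ⟨h, hh, hexp⟩ p hp g hg
    have hpow : ∀ m : ℕ, ((h ^ m : GL (Fin n) k) : Matrix (Fin n) (Fin n) k) =
        IsNilpotent.exp ((m : k) • X) := by
      intro m
      induction m with
      | zero => simp
      | succ m ih =>
        rw [pow_succ, Units.val_mul, ih, hexp, Nat.cast_succ, add_smul, one_smul,
          IsNilpotent.exp_add_of_commute ((Commute.refl X).smul_left _)
            (hX.smul _).isNilpotent hX.isNilpotent]
    have hzero : alongCurve (g : Matrix (Fin n) (Fin n) k) X N p = 0 := by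
      refine Polynomial.eq_zero_of_infinite_isRoot _ ?_
      refine (Set.infinite_range_of_injective (Nat.cast_injective (R := k))).mono ?_
      rintro _ ⟨m, rfl⟩
      change Polynomial.eval _ _ = 0
      rw [eval_alongCurve _ hN, ← hpow, ← Units.val_mul]
      exact hp _ (U.mul_mem hg (U.pow_mem hh m))
    have h0 := eval_alongCurve (g : Matrix (Fin n) (Fin n) k) hN 0 (leftDeriv X p)
    rw [← derivative_alongCurve _ hN, hzero] at h0
    simpa using h0.symm
  · intro hD
    obtain ⟨S, hS⟩ := hU
    have hvan : ∀ p, VanishesOn U p → evalAt (IsNilpotent.exp X) p = 0 := by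
      intro p hp
      have hit : ∀ m : ℕ, VanishesOn U ((leftDeriv X)^[m] p) := by
        intro m
        induction m with
        | zero => exact hp
        | succ m ih => rw [Function.iterate_succ_apply']; exact hD _ ih
      have hder : ∀ m : ℕ, Polynomial.derivative^[m] (alongCurve 1 X N p) =
          alongCurve 1 X N ((leftDeriv X)^[m] p) := by
        intro m
        induction m with
        | zero => rfl
        | succ m ih =>
          rw [Function.iterate_succ_apply', Function.iterate_succ_apply', ih,
            derivative_alongCurve _ hN]
      have hzero : alongCurve 1 X N p = 0 := by
        ext m
        have h1 : (Polynomial.derivative^[m] (alongCurve 1 X N p)).coeff 0 = 0 := by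
          rw [hder, Polynomial.coeff_zero_eq_eval_zero, eval_alongCurve _ hN]
          simpa using hit m 1 U.one_mem
        rw [Polynomial.coeff_iterate_derivative] at h1
        have h2 : ((0 + m).descFactorial m : k) ≠ 0 := by
          rw [zero_add, Nat.descFactorial_self]
          exact Nat.cast_ne_zero.mpr m.factorial_ne_zero
        rw [nsmul_eq_mul, zero_add] at h1
        rw [zero_add] at h2
        simpa using (mul_eq_zero.mp h1).resolve_left h2
      have h1 := eval_alongCurve 1 hN 1 p
      rw [hzero] at h1
      simpa using h1.symm
    obtain ⟨e, he⟩ := IsNilpotent.isUnit_exp hX.isNilpotent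
    refine ⟨e, (hS e).mpr ⟨?_, fun p hp => ?_⟩, he⟩
    · rw [he]
      exact hX.isUpperUnitriangular_exp
    · rw [he]
      exact hvan p fun g hg => ((hS g).mp hg).2 p hp

/-- The Lie algebra `𝔲 = log(U)` of the unipotent algebraic group `U`, as a Lie subalgebra of the
Lie algebra of all matrices (with the commutator bracket). -/
def lieAlg (U : Subgroup (GL (Fin n) k)) (hU : IsUnipotentAlgebraic U) :
    LieSubalgebra k (Matrix (Fin n) (Fin n) k) where
  carrier := logSet U
  add_mem' := by
    intro X Y hX hY
    rw [mem_logSet_iff hU] at hX hY ⊢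
    refine ⟨hX.1.add hY.1, fun p hp g hg => ?_⟩
    have h1 := hX.2 p hp g hg
    have h2 := hY.2 p hp g hg
    rw [evalAt] at h1 h2 ⊢
    rw [leftDeriv_add, Derivation.add_apply, map_add, h1, h2, add_zero]
  zero_mem' := ⟨fun _ _ _ => rfl, 1, U.one_mem, by simp⟩
  smul_mem' := by
    intro c X hX
    rw [mem_logSet_iff hU] at hX ⊢
    refine ⟨hX.1.smul c, fun p hp g hg => ?_⟩
    have h1 := hX.2 p hp g hg
    rw [evalAt] at h1 ⊢
    rw [leftDeriv_smul, Derivation.smul_apply, MvPolynomial.smul_eval, h1, mul_zero]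
  lie_mem' := by
    intro X Y hX hY
    change X ∈ logSet U at hX
    change Y ∈ logSet U at hY
    rw [mem_logSet_iff hU] at hX hY ⊢
    refine ⟨hX.1.lie hY.1, fun p hp g hg => ?_⟩
    have h1 := hX.2 _ (hY.2 p hp) g hg
    have h2 := hY.2 _ (hX.2 p hp) g hg
    rw [evalAt] at h1 h2 ⊢
    rw [leftDeriv_lie, Derivation.commutator_apply, map_sub, h1, h2, sub_zero]

variable (U : Subgroup (GL (Fin n) k)) (hU : IsUnipotentAlgebraic U)

/-- The exponential map `exp : 𝔲 → U`: the element of `U` (an invertible matrix, hence unique)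
whose underlying matrix is `∑ m, X ^ m / m!`; see `coe_expMap`. -/
noncomputable def expMap (X : lieAlg U hU) : U :=
  ⟨X.2.2.choose, X.2.2.choose_spec.1⟩

theorem coe_expMap (X : lieAlg U hU) :
    ((expMap U hU X : GL (Fin n) k) : Matrix (Fin n) (Fin n) k) =
      IsNilpotent.exp (X : Matrix (Fin n) (Fin n) k) :=
  X.2.2.choose_spec.2

theorem exp_conj (u : GL (Fin n) k) {X : Matrix (Fin n) (Fin n) k} (hX : IsNilpotent X) :
    IsNilpotent.exp ((u : Matrix (Fin n) (Fin n) k) * X * ((u⁻¹ : GL (Fin n) k) : Matrix _ _ k)) =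
      (u : Matrix (Fin n) (Fin n) k) * IsNilpotent.exp X *
        ((u⁻¹ : GL (Fin n) k) : Matrix _ _ k) := by
  obtain ⟨N, hN⟩ := hX
  have hp : ∀ m : ℕ,
      ((u : Matrix (Fin n) (Fin n) k) * X * ((u⁻¹ : GL (Fin n) k) : Matrix _ _ k)) ^ m =
        (u : Matrix (Fin n) (Fin n) k) * X ^ m * ((u⁻¹ : GL (Fin n) k) : Matrix _ _ k) :=
    fun m => Units.conj_pow u X m
  rw [IsNilpotent.exp_eq_sum hN, IsNilpotent.exp_eq_sum (k := N) (by rw [hp, hN]; simp),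
    Finset.mul_sum, Finset.sum_mul]
  refine Finset.sum_congr rfl fun m _ => ?_
  rw [hp, mul_smul_comm, smul_mul_assoc]

theorem conj_mem_lieAlg (u : U) (X : lieAlg U hU) :
    ((u : GL (Fin n) k) : Matrix (Fin n) (Fin n) k) * (X : Matrix (Fin n) (Fin n) k) *
      (((u : GL (Fin n) k)⁻¹ : GL (Fin n) k) : Matrix (Fin n) (Fin n) k) ∈ lieAlg U hU := by
  obtain ⟨X, hX, g, hg, hgX⟩ := X
  have hu : ∀ v ∈ U, IsUpperUnitriangular (v : Matrix (Fin n) (Fin n) k) := by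
    obtain ⟨S, hS⟩ := hU
    exact fun v hv => ((hS v).mp hv).1
  refine ⟨IsStrictlyUpper.mul_right (IsStrictlyUpper.mul_left (hu _ u.2).2 hX)
    (hu _ (U.inv_mem u.2)).2, u * g * u⁻¹, U.mul_mem (U.mul_mem u.2 hg) (U.inv_mem u.2), ?_⟩
  rw [exp_conj _ hX.isNilpotent, ← hgX, Units.val_mul, Units.val_mul]
  rfl

/-- The adjoint action of `U` on `𝔲`: `Ad(u)` is the automorphism `X ↦ u X u⁻¹` of the Lie algebra
`𝔲`. -/
noncomputable def Ad (u : U) : lieAlg U hU ≃ₗ⁅k⁆ lieAlg U hU where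
  toFun X := ⟨_, conj_mem_lieAlg U hU u X⟩
  invFun X := ⟨_, conj_mem_lieAlg U hU u⁻¹ X⟩
  map_add' X Y := Subtype.ext (by simp [mul_add, add_mul])
  map_smul' c X := Subtype.ext (by simp)
  map_lie' := by
    intro X Y
    refine Subtype.ext ?_
    simp only [LieSubalgebra.coe_bracket, Ring.lie_def, mul_sub, sub_mul]
    congr 1 <;> simp only [mul_assoc, Units.inv_mul_cancel_left]
  left_inv X := Subtype.ext (by simp [mul_assoc])
  right_inv X := Subtype.ext (by simp [mul_assoc])

/-- `Ad(u)` is determined by the property `exp (Ad(u) X) = u (exp X) u⁻¹`. -/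
theorem expMap_Ad (u : U) (X : lieAlg U hU) :
    expMap U hU (Ad U hU u X) = u * expMap U hU X * u⁻¹ := by
  refine Subtype.ext (Units.ext ?_)
  rw [coe_expMap]
  simp only [Subgroup.coe_mul, Subgroup.coe_inv, Units.val_mul, coe_expMap]
  exact exp_conj _ X.2.1.isNilpotent

/-- The action of `U` through `Ad` on the additive group of `𝔲` (written multiplicatively). -/
noncomputable def adAction : U →* MulAut (Multiplicative (lieAlg U hU)) where
  toFun u := AddEquiv.toMultiplicative (Ad U hU u).toLinearEquiv.toAddEquiv
  map_one' := by
    refine MulEquiv.ext fun X => ?_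
    refine Multiplicative.toAdd.injective (Subtype.ext ?_)
    change ((1 : GL (Fin n) k) : Matrix (Fin n) (Fin n) k) * _ *
      ((1⁻¹ : GL (Fin n) k) : Matrix (Fin n) (Fin n) k) = _
    simp
  map_mul' u v := by
    refine MulEquiv.ext fun X => ?_
    refine Multiplicative.toAdd.injective (Subtype.ext ?_)
    change ((u * v : GL (Fin n) k) : Matrix (Fin n) (Fin n) k) * (X.toAdd : Matrix _ _ k) *
      (((u * v : GL (Fin n) k)⁻¹ : GL (Fin n) k) : Matrix (Fin n) (Fin n) k) =
      ((u : GL (Fin n) k) : Matrix (Fin n) (Fin n) k) *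
        (((v : GL (Fin n) k) : Matrix (Fin n) (Fin n) k) * (X.toAdd : Matrix _ _ k) *
      (((v : GL (Fin n) k)⁻¹ : GL (Fin n) k) : Matrix (Fin n) (Fin n) k)) *
      (((u : GL (Fin n) k)⁻¹ : GL (Fin n) k) : Matrix (Fin n) (Fin n) k)
    rw [mul_inv_rev, Units.val_mul, Units.val_mul]
    simp only [mul_assoc]

/-- `Tr(𝔲, Ad(U))`: the `Ad(U)`-invariant traces on the additive group of `𝔲`. -/
def adTraces : Set (Multiplicative (lieAlg U hU) → ℂ) :=
  invariantTraces (adAction U hU)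

/-- The pull-back `φ ↦ φ ∘ exp` of functions on `U` to functions on `𝔲`. -/
noncomputable def compExp (φ : U → ℂ) : Multiplicative (lieAlg U hU) → ℂ :=
  fun X => φ (expMap U hU X.toAdd)

end Matrices

end UnipotentTraces

/-!
Both `Tr(U)` and `Tr(𝔲, Ad(U))` are sets of functions on the vector space `𝔲`, invariant under
`Ad(U)` and of positive type for a group law on `𝔲`: the Campbell–Hausdorff product
`log (exp X exp Y)` in the first case, the addition in the second. The two group laws share the
following property (`IsAdaptedChart`): for an ideal `I` of `𝔲` and `Y` central modulo `I`, the
product of `X` and `Y` is `X + Y` modulo `I`. This property, together with the shape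
`Ad(exp Y) X = X + ⁅Y, X⁆ + ⋯` of the adjoint action (`IsAdjointFamily`), is all that is needed:
`chartTraces_subset` shows that the set of traces is the same for all group laws of this kind.

The set of traces is convex and compact for pointwise convergence, so by the Krein–Milman theorem
only an extreme trace `f` has to be considered. Let `I` be an ideal which is maximal among those on
which `f` is `1`, and let `Z` be its normalizer, the preimage of the centre of `𝔲 / I`. Then:

* `f (X + z) = f X * f z` for `z ∈ Z`, since central elements act by scalars in an extreme trace
  (`map_add_eq_mul_of_mem_extremePoints`);
* `f` vanishes on the next step of the upper central series above `Z`, outside `Z`: for `f X ≠ 0`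
  the invariance of `f` gives `f ⁅Y, X⁆ = 1` for all `Y`, against the maximality of `I`
  (`eq_zero_of_mem_normalizer_normalizer`);
* `f` vanishes on each further step, because an element there has infinitely many conjugates which
  are orthogonal for the scalar product defined by `f` (`eq_zero_of_vanishing_on_normalizer`).

As `𝔲` is nilpotent, `f` is the trivial extension of a unitary character of the additive group `Z`.
On `Z`, all the group laws in question agree modulo `I`, where the character is trivial, so `f` is
the trivial extension of a unitary character from a subgroup for each of them, and therefore of
positive type (`isPositiveType_of_subgroup`).

That the Campbell–Hausdorff product has the property above is `log_exp_mul_exp_sub_mem`. The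
logarithm of a unipotent matrix exists over any commutative `ℚ`-algebra, so `exp X exp (t Y)` is the
exponential of a polynomial curve `W(t)`. The formula for the derivative of the exponential reads
`Y = W' - ⁅W, W'⁆ / 2 + ⋯`. Inverted modulo `I`, where `Y` is central, it gives `W' = Y`.
-/

namespace UnipotentTraces

/-! ### Functions of positive type -/

section PositiveType

open scoped ComplexOrder ComplexConjugate
open Finset

variable {Γ : Type*} [Group Γ] {φ ψ : Γ → ℂ}

theorem isPositiveType_iff : IsPositiveType φ ↔ ∀ (m : ℕ) (c : Fin m → ℂ) (γ : Fin m → Γ),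
    0 ≤ ∑ i, ∑ j, c i * conj (c j) * φ ((γ j)⁻¹ * γ i) := by
  have h : ∀ z : ℂ, (∃ r : ℝ, 0 ≤ r ∧ z = r) ↔ 0 ≤ z := fun z => by
    constructor
    · rintro ⟨r, hr, rfl⟩
      exact_mod_cast hr
    · intro hz
      exact ⟨z.re, (Complex.nonneg_iff.mp hz).1, Complex.ext rfl (Complex.nonneg_iff.mp hz).2.symm⟩
  simp only [IsPositiveType, h]

theorem IsPositiveType.sum_nonneg (hφ : IsPositiveType φ) {ι : Type*} [Fintype ι] (c : ι → ℂ)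
    (γ : ι → Γ) : 0 ≤ ∑ i, ∑ j, c i * conj (c j) * φ ((γ j)⁻¹ * γ i) := by
  have e := Fintype.equivFin ι
  have h := isPositiveType_iff.mp hφ _ (c ∘ e.symm) (γ ∘ e.symm)
  rw [← e.symm.sum_comp]
  simp_rw [← e.symm.sum_comp (fun j => c _ * conj (c j) * φ ((γ j)⁻¹ * γ _))]
  exact h

theorem IsPositiveType.add (hφ : IsPositiveType φ) (hψ : IsPositiveType ψ) :
    IsPositiveType (φ + ψ) := by
  rw [isPositiveType_iff] at *
  intro m c γ
  simpa only [Pi.add_apply, mul_add, sum_add_distrib] using add_nonneg (hφ m c γ) (hψ m c γ)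

theorem IsPositiveType.smul (hφ : IsPositiveType φ) {r : ℝ} (hr : 0 ≤ r) :
    IsPositiveType (r • φ) := by
  rw [isPositiveType_iff] at *
  intro m c γ
  have h := mul_nonneg (Complex.zero_le_real.mpr hr) (hφ m c γ)
  refine h.trans_eq ?_
  simp only [mul_sum, Pi.smul_apply, Complex.real_smul]
  exact sum_congr rfl fun i _ => sum_congr rfl fun j _ => by ring

theorem isClosed_isPositiveType : IsClosed {φ : Γ → ℂ | IsPositiveType φ} := by
  simp only [isPositiveType_iff, Set.ofPred_forall, Complex.nonneg_iff, Set.ofPred_and]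
  refine isClosed_iInter fun m => isClosed_iInter fun c => isClosed_iInter fun γ => ?_
  exact (isClosed_le (by fun_prop) (by fun_prop)).inter (isClosed_eq (by fun_prop) (by fun_prop))

theorem IsPositiveType.map_one_nonneg (hφ : IsPositiveType φ) : 0 ≤ φ 1 := by
  simpa using hφ.sum_nonneg (ι := Unit) (fun _ => 1) (fun _ => 1)

theorem IsPositiveType.two_point (hφ : IsPositiveType φ) (x : Γ) (c : ℂ) :
    0 ≤ φ 1 + c * conj c * φ 1 + (c * φ x + conj c * φ x⁻¹) := by
  have h := hφ.sum_nonneg (ι := Fin 2) ![1, c] ![1, x]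
  simp [Fin.sum_univ_two] at h
  convert h using 1
  ring

theorem IsPositiveType.map_inv (hφ : IsPositiveType φ) (x : Γ) : φ x⁻¹ = conj (φ x) := by
  have h1 := (Complex.nonneg_iff.mp (hφ.two_point x 1)).2
  have hI := (Complex.nonneg_iff.mp (hφ.two_point x Complex.I)).2
  have h0 := (Complex.nonneg_iff.mp hφ.map_one_nonneg).2
  simp at h1 hI
  apply Complex.ext <;> simp <;> linarith

theorem IsPositiveType.norm_le (hφ : IsPositiveType φ) (x : Γ) : ‖φ x‖ ≤ (φ 1).re := by
  rcases eq_or_ne (φ x) 0 with h | h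
  · simpa [h] using (Complex.nonneg_iff.mp hφ.map_one_nonneg).1
  have hn : (‖φ x‖ : ℂ) ≠ 0 := by simpa using h
  have h2 : conj (φ x) * φ x = (‖φ x‖ : ℂ) ^ 2 := Complex.conj_mul' _
  -- the coefficient which turns `φ x` into `-‖φ x‖`
  have key := (Complex.nonneg_iff.mp (hφ.two_point x (-conj (φ x) / ‖φ x‖))).1
  have e : φ 1 + -conj (φ x) / ‖φ x‖ * conj (-conj (φ x) / ‖φ x‖) * φ 1 +
      (-conj (φ x) / ‖φ x‖ * φ x + conj (-conj (φ x) / ‖φ x‖) * φ x⁻¹) =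
      φ 1 + φ 1 - ‖φ x‖ - ‖φ x‖ := by
    rw [hφ.map_inv]
    simp only [map_div₀, map_neg, Complex.conj_conj, Complex.conj_ofReal]
    field_simp
    linear_combination (φ 1 - 2 * (‖φ x‖ : ℂ)) * h2
  rw [e] at key
  simp at key
  linarith

/-- A normalized function of positive type is invariant under translation by elements at which it
takes the value `1`. -/
theorem IsPositiveType.map_mul_of_eq_one (hφ : IsPositiveType φ) (h1 : φ 1 = 1) {a : Γ}
    (ha : φ a = 1) (x : Γ) : φ (x * a) = φ x := by
  have ha' : φ a⁻¹ = 1 := by rw [hφ.map_inv, ha, map_one]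
  -- the points `x⁻¹, 1, a` with the coefficients `1, s, -s`: there is no term in `|s|²`
  have key : ∀ s : ℂ, 0 ≤ 1 + 2 * (s * (φ x - φ (x * a))).re := by
    intro s
    have h := hφ.sum_nonneg (ι := Fin 3) ![1, s, -s] ![x⁻¹, 1, a]
    have hxa : φ (a⁻¹ * x⁻¹) = conj (φ (x * a)) := by rw [← hφ.map_inv, mul_inv_rev]
    simp [Fin.sum_univ_three, h1, ha, ha', hxa, hφ.map_inv x] at h
    have h := (Complex.le_def.mp h).1
    simp at h ⊢
    linarith
  by_contra hne
  have hd : φ x - φ (x * a) ≠ 0 := sub_ne_zero.mpr (Ne.symm hne)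
  have := key (-(φ x - φ (x * a))⁻¹)
  rw [neg_mul, inv_mul_cancel₀ hd] at this
  norm_num at this

/-- If the translates `γ m` are orthogonal for the scalar product defined by `φ`, then Bessel's
inequality shows that the value of `φ` at infinitely many of them cannot be a nonzero constant. -/
theorem IsPositiveType.eq_zero_of_orthogonal (hφ : IsPositiveType φ) (h1 : φ 1 = 1) (γ : ℕ → Γ)
    {z : ℂ} (hz : ∀ m, φ (γ m) = z) (hγ : ∀ m l, m ≠ l → φ ((γ m)⁻¹ * γ l) = 0) : z = 0 := by
  -- the points `1, γ 0, …, γ (M - 1)` with the coefficients `1, -conj z, …, -conj z`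
  have key : ∀ M : ℕ, (M : ℝ) * ‖z‖ ^ 2 ≤ 1 := by
    intro M
    have h := hφ.sum_nonneg (ι := Option (Fin M)) (fun o => o.elim 1 (fun _ => -conj z))
      (fun o => o.elim 1 (fun m => γ m))
    have hinner : ∀ i : Fin M, ∑ j : Fin M, conj z * z * φ ((γ j)⁻¹ * γ i) = conj z * z := by
      intro i
      rw [Finset.sum_eq_single i]
      · simp [h1]
      · intro j _ hj
        rw [hγ _ _ (by simpa [Fin.ext_iff] using hj), mul_zero]
      · simp
    simp [Fintype.sum_option, h1, hz, hφ.map_inv, sum_add_distrib, hinner] at h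
    have h := (Complex.le_def.mp h).1
    have e : (z * conj z) = ((‖z‖ ^ 2 : ℝ) : ℂ) := by rw [Complex.mul_conj']; norm_cast
    rw [e] at h
    exact_mod_cast h
  by_contra hne
  obtain ⟨M, hM⟩ := exists_nat_gt (1 / ‖z‖ ^ 2)
  rw [div_lt_iff₀ (by positivity)] at hM
  linarith [key M]

/-- In terms of the unitary representation `π` with cyclic vector `ξ` attached to `φ`, the sums in
the definition of positive type are `‖(1 + c π(z)) v‖²`, where `v` is a linear combination of
translates of `ξ`. -/
theorem IsPositiveType.twist (hφ : IsPositiveType φ) (hc : ∀ a b, φ (a * b) = φ (b * a)) (z : Γ)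
    {c : ℂ} (hcc : c * conj c = 1) :
    IsPositiveType fun x => 2 * φ x + c * φ (x * z) + conj c * φ (x * z⁻¹) := by
  rw [isPositiveType_iff]
  intro m d γ
  have h := hφ.sum_nonneg (ι := Fin m ⊕ Fin m) (Sum.elim d (fun i => c * d i))
    (Sum.elim γ (fun i => γ i * z))
  simp only [Fintype.sum_sum_type, Sum.elim_inl, Sum.elim_inr, ← sum_add_distrib] at h
  convert h using 4 with i _ j _
  have e1 : φ ((γ j * z)⁻¹ * γ i) = φ ((γ j)⁻¹ * γ i * z⁻¹) := by
    rw [mul_inv_rev, mul_assoc, hc]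
  have e2 : φ ((γ j * z)⁻¹ * (γ i * z)) = φ ((γ j)⁻¹ * γ i) := by
    rw [mul_inv_rev, mul_assoc, hc]
    group
  rw [e1, e2, ← mul_assoc]
  simp only [map_mul]
  linear_combination (-(d i * conj (d j) * φ ((γ j)⁻¹ * γ i))) * hcc

/-- The trivial extension of a unitary character from a subgroup `H` to the whole group is of
positive type. -/
theorem isPositiveType_of_subgroup (H : Subgroup Γ) (hφ0 : ∀ x ∉ H, φ x = 0)
    (hmul : ∀ x ∈ H, ∀ y ∈ H, φ (x * y) = φ x * φ y) (hinv : ∀ x ∈ H, φ x⁻¹ = conj (φ x)) :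
    IsPositiveType φ := by
  classical
  rw [isPositiveType_iff]
  intro m c γ
  -- the sum is grouped by the cosets of `H`, each of which contributes a square
  let q : Fin m → Γ ⧸ H := fun i => (γ i : Γ ⧸ H)
  let h : Fin m → Γ := fun i => (q i).out⁻¹ * γ i
  have hmem : ∀ i, h i ∈ H := fun i => by
    rw [← QuotientGroup.eq, QuotientGroup.out_eq']
  have key : ∀ i j, φ ((γ j)⁻¹ * γ i) = if q i = q j then φ (h i) * conj (φ (h j)) else 0 := by
    intro i j
    split_ifs with hij
    · have e : (γ j)⁻¹ * γ i = (h j)⁻¹ * h i := by simp [h, hij]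
      rw [e, hmul _ (H.inv_mem (hmem j)) _ (hmem i), hinv _ (hmem j), mul_comm]
    · exact hφ0 _ fun hH => hij (QuotientGroup.eq.mpr hH).symm
  have e : ∑ i, ∑ j, c i * conj (c j) * φ ((γ j)⁻¹ * γ i) =
      ∑ s ∈ univ.image q, (∑ i with q i = s, c i * φ (h i)) *
        conj (∑ i with q i = s, c i * φ (h i)) := by
    have e1 : ∀ s, (∑ i with q i = s, c i * φ (h i)) * conj (∑ i with q i = s, c i * φ (h i)) =
        ∑ i with q i = s, ∑ j, c i * conj (c j) * φ ((γ j)⁻¹ * γ i) := by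
      intro s
      rw [map_sum, sum_mul_sum]
      refine sum_congr rfl fun i hi => ?_
      rw [sum_filter]
      refine sum_congr rfl fun j _ => ?_
      rw [key, (mem_filter.mp hi).2]
      simp only [eq_comm (a := s), map_mul]
      split_ifs <;> ring
    simp only [e1]
    rw [sum_fiberwise_of_maps_to (fun i _ => mem_image_of_mem q (mem_univ i))]
  rw [e]
  exact sum_nonneg fun s _ => by rw [Complex.mul_conj]; exact_mod_cast Complex.normSq_nonneg _

end PositiveType

/-! ### Traces in a chart adapted to a nilpotent Lie algebra -/

section Charts

open scoped ComplexConjugate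

variable (k : Type*) {L Γ G : Type*} [Field k] [LieRing L] [LieAlgebra k L] [Group Γ]

/-- The properties of the family of maps `Ad(g)`, `g ∈ G`, on the Lie algebra `L` of a unipotent
group `G` that are used below: modulo ideals of `L` these maps are given by the first terms of the
exponential series `Ad(exp Y) X = X + ⁅Y, X⁆ + ⁅Y, ⁅Y, X⁆⁆ / 2 + ⋯`. -/
structure IsAdjointFamily (A : G → L → L) : Prop where
  map_add : ∀ g X Y, A g (X + Y) = A g X + A g Y
  sub_mem : ∀ g (I : LieIdeal k L), ∀ X ∈ I.normalizer, A g X - X ∈ I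
  exists_sub_mem : ∀ Y : L, ∃ g, ∀ I : LieIdeal k L, ∀ X ∈ I.normalizer.normalizer,
    A g X - X - ⁅Y, X⁆ ∈ I

/-- A bijection `e` from the Lie algebra `L` onto a group `Γ` is adapted to the family `A` of maps
`L → L` if the group law of `Γ`, transported to `L`, agrees with the addition of `L` up to an ideal
`I` as soon as one of the two factors is central modulo `I`, and conjugations become maps of the
family. The examples are the exponential map of a unipotent group and the identity map onto the
additive group of `L`. -/
structure IsAdaptedChart (A : G → L → L) (e : L ≃ Γ) : Prop where
  map_neg : ∀ X, e (-X) = (e X)⁻¹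
  mul_mem : ∀ (I : LieIdeal k L) (X : L), ∀ Y ∈ I.normalizer, e.symm (e X * e Y) - X - Y ∈ I
  exists_conj : ∀ X, ∃ g, ∀ Y, e X * e Y * (e X)⁻¹ = e (A g Y)

/-- The normalized functions on `L` that are invariant under the family `A` and are of positive
type with respect to the group law transported to `L` by the chart `e`. -/
def chartTraces (A : G → L → L) (e : L ≃ Γ) : Set (L → ℂ) :=
  {f | IsPositiveType (f ∘ e.symm) ∧ (∀ g X, f (A g X) = f X) ∧ f 0 = 1}

variable {k} {A : G → L → L} {e : L ≃ Γ}

namespace IsAdaptedChart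

theorem exists_mul (he : IsAdaptedChart k A e) (I : LieIdeal k L) (X : L) {Y : L}
    (hY : Y ∈ I.normalizer) : ∃ a ∈ I, e X * e Y = e (X + Y + a) :=
  ⟨_, he.mul_mem I X Y hY, by rw [← e.symm_apply_eq]; abel⟩

theorem map_zero (he : IsAdaptedChart k A e) : e 0 = 1 := by
  obtain ⟨a, ha, h⟩ := he.exists_mul ⊥ 0 (LieSubmodule.zero_mem (⊥ : LieIdeal k L).normalizer)
  rw [LieSubmodule.mem_bot] at ha
  simpa [ha] using h

theorem exists_add_eq_mul (he : IsAdaptedChart k A e) (I : LieIdeal k L) (X : L) {V : L}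
    (hV : V ∈ I.normalizer) : ∃ a ∈ I, e (X + V) = e (X + a) * e V := by
  obtain ⟨a, ha, h⟩ := he.exists_mul I (X + V) (neg_mem hV)
  refine ⟨a, ha, ?_⟩
  rw [he.map_neg, mul_inv_eq_iff_eq_mul, add_neg_cancel_right] at h
  exact h

variable [LieRing.IsNilpotent L]

/-- The left translates of an ideal are the same for both group structures; the two are compared on
the ideals of the upper central series successively. -/
theorem exists_add_of_mem (he : IsAdaptedChart k A e) (I : LieIdeal k L) (X : L) {V : L}
    (hV : V ∈ I) : ∃ a ∈ I, e (X + V) = e X * e a := by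
  have key : ∀ (n : ℕ) (J : LieIdeal k L), J ≤ I → J ≤ (⊥ : LieIdeal k L).ucs n →
      ∀ X : L, ∀ V ∈ J, ∃ a ∈ I, e (X + V) = e X * e a := by
    intro n
    induction n with
    | zero =>
      intro J _ hJ X V hV
      have hV0 : V = 0 := (LieSubmodule.mem_bot V).mp (hJ hV)
      exact ⟨0, I.zero_mem, by rw [hV0, add_zero, he.map_zero, mul_one]⟩
    | succ n ih =>
      intro J hJI hJ X V hV
      have hV' : V ∈ (J ⊓ (⊥ : LieIdeal k L).ucs n).normalizer := by
        rw [LieSubmodule.normalizer_inf, ← LieSubmodule.ucs_succ]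
        exact ⟨J.le_normalizer hV, hJ hV⟩
      obtain ⟨a, ha, h1⟩ := he.exists_add_eq_mul _ X hV'
      obtain ⟨b, hb, h2⟩ := ih _ (inf_le_left.trans hJI) inf_le_right X a ha
      obtain ⟨c, hc, h3⟩ := he.exists_mul I b (I.le_normalizer (hJI hV))
      exact ⟨b + V + c, add_mem (add_mem hb (hJI hV)) hc, by rw [h1, h2, mul_assoc, h3]⟩
  obtain ⟨n, hn⟩ := (LieModule.isNilpotent_iff_exists_ucs_eq_top (R := k) (L := L) (M := L)).mp ‹_›
  exact key n I le_rfl (hn ▸ le_top) X V hV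

theorem exists_add_of_mem_normalizer (he : IsAdaptedChart k A e) (I : LieIdeal k L) (X : L) {V : L}
    (hV : V ∈ I.normalizer) : ∃ a ∈ I, e (X + V) = e X * e (V + a) := by
  obtain ⟨a, ha, h1⟩ := he.exists_add_eq_mul I X hV
  obtain ⟨b, hb, h2⟩ := he.exists_add_of_mem I X ha
  obtain ⟨c, hc, h3⟩ := he.exists_mul I b hV
  exact ⟨b + c, add_mem hb hc, by rw [h1, h2, mul_assoc, h3]; congr 2; abel⟩

end IsAdaptedChart

section Invariance

variable {f : L → ℂ}

theorem map_mul_comm_of_invariant (he : IsAdaptedChart k A e) (hf : ∀ g X, f (A g X) = f X)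
    (a b : Γ) : (f ∘ e.symm) (a * b) = (f ∘ e.symm) (b * a) := by
  obtain ⟨g, hg⟩ := he.exists_conj (e.symm a)
  have h := hg (e.symm (b * a))
  rw [e.apply_symm_apply, e.apply_symm_apply, ← mul_assoc, mul_inv_cancel_right] at h
  rw [h]
  simp [hf]

/-- `f` is invariant under translations by an ideal on which it takes the value `1`. -/
theorem map_add_of_eq_one [LieRing.IsNilpotent L] (he : IsAdaptedChart k A e)
    (hf : f ∈ chartTraces A e) {I : LieIdeal k L} (hI : ∀ V ∈ I, f V = 1) (X : L) {V : L}
    (hV : V ∈ I) : f (X + V) = f X := by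
  obtain ⟨a, ha, h⟩ := he.exists_add_of_mem I X hV
  have h1 : (f ∘ e.symm) 1 = 1 := by
    rw [← he.map_zero]
    simpa using hf.2.2
  have h2 := hf.1.map_mul_of_eq_one h1 (a := e a) (by simpa using hI a ha) (e X)
  rw [← h] at h2
  simpa using h2

theorem isCompact_chartTraces (he : IsAdaptedChart k A e) : IsCompact (chartTraces A e) := by
  have hcl : IsClosed (chartTraces A e) := by
    have h1 : IsClosed {f : L → ℂ | IsPositiveType (f ∘ e.symm)} :=
      isClosed_isPositiveType.preimage (f := fun f : L → ℂ => f ∘ e.symm) (by fun_prop)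
    have h2 : IsClosed {f : L → ℂ | ∀ g X, f (A g X) = f X} := by
      simp only [Set.ofPred_forall]
      exact isClosed_iInter fun g => isClosed_iInter fun X =>
        isClosed_eq (by fun_prop) (by fun_prop)
    have h3 : IsClosed {f : L → ℂ | f 0 = 1} := isClosed_eq (by fun_prop) (by fun_prop)
    exact h1.inter (h2.inter h3)
  refine (isCompact_univ_pi fun _ : L => isCompact_closedBall (0 : ℂ) 1).of_isClosed_subset hcl ?_
  intro f hf X _
  have h := hf.1.norm_le (e X)
  rw [← he.map_zero] at h
  simpa [hf.2.2] using h

theorem convex_chartTraces : Convex ℝ (chartTraces A e) := by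
  intro f hf f' hf' a b ha hb hab
  refine ⟨(hf.1.smul ha).add (hf'.1.smul hb), fun g X => ?_, ?_⟩
  · simp [hf.2.1 g X, hf'.2.1 g X]
  · simp [hf.2.2, hf'.2.2, ← Complex.ofReal_add, hab]

/-- An extreme point of the set of traces spans an extreme ray of the cone of invariant functions of
positive type. -/
theorem eq_smul_of_mem_extremePoints (he : IsAdaptedChart k A e)
    (hf : f ∈ (chartTraces A e).extremePoints ℝ) {F F' : L → ℂ}
    (hF : IsPositiveType (F ∘ e.symm)) (hF' : IsPositiveType (F' ∘ e.symm))
    (hFA : ∀ g X, F (A g X) = F X) (hFA' : ∀ g X, F' (A g X) = F' X)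
    (hsum : ∀ X, F X + F' X = 4 * f X) (X : L) : F X = F 0 * f X := by
  have hsymm : e.symm 1 = 0 := by rw [← he.map_zero, e.symm_apply_apply]
  -- the values at the origin are nonnegative real numbers which dominate the function
  have hpos : ∀ {H : L → ℂ}, IsPositiveType (H ∘ e.symm) →
      ∃ r : ℝ, 0 ≤ r ∧ H 0 = r ∧ ∀ X, ‖H X‖ ≤ r := by
    intro H hH
    have h1 := Complex.nonneg_iff.mp hH.map_one_nonneg
    simp only [Function.comp_apply, hsymm] at h1
    refine ⟨(H 0).re, h1.1, Complex.ext rfl h1.2.symm, fun X => ?_⟩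
    have h2 := hH.norm_le (e X)
    simpa [hsymm] using h2
  obtain ⟨r, hr, hr0, hrn⟩ := hpos hF
  obtain ⟨r', hr', hr0', hrn'⟩ := hpos hF'
  have hrr : r + r' = 4 := by
    have := hsum 0
    rw [hr0, hr0', hf.1.2.2] at this
    exact_mod_cast this
  rcases hr.eq_or_lt with rfl | hr
  · have : F X = 0 := by simpa using hrn X
    rw [this, hr0]
    simp
  rcases hr'.eq_or_lt with rfl | hr'
  · have h0 : F' X = 0 := by simpa using hrn' X
    have h4 : r = 4 := by linarith
    have := hsum X
    rw [h0, add_zero] at this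
    rw [this, hr0, h4]
    norm_num
  have hmem : ∀ {H : L → ℂ} {s : ℝ}, 0 < s → H 0 = s → IsPositiveType (H ∘ e.symm) →
      (∀ g X, H (A g X) = H X) → s⁻¹ • H ∈ chartTraces A e := by
    intro H s hs hs0 hH hHA
    refine ⟨hH.smul (inv_nonneg.mpr hs.le), fun g X => by simp [hHA g X], ?_⟩
    have : (s : ℂ) ≠ 0 := by exact_mod_cast hs.ne'
    simp [hs0, this]
  have hseg : f ∈ openSegment ℝ (r⁻¹ • F) (r'⁻¹ • F') := by
    refine ⟨r / 4, r' / 4, by positivity, by positivity, by linarith, ?_⟩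
    funext Y
    have h1 : (r : ℂ) ≠ 0 := by exact_mod_cast hr.ne'
    have h2 : (r' : ℂ) ≠ 0 := by exact_mod_cast hr'.ne'
    have := hsum Y
    simp only [Pi.add_apply, Pi.smul_apply, Complex.real_smul]
    push_cast
    field_simp
    linear_combination this
  have h := (mem_extremePoints.mp hf).2 _ (hmem hr hr0 hF hFA) _ (hmem hr' hr0' hF' hFA') hseg
  have h1 : (r : ℂ) ≠ 0 := by exact_mod_cast hr.ne'
  rw [← h.1, hr0]
  simp only [Pi.smul_apply, Complex.real_smul]
  push_cast
  field_simp

/-- Schur's lemma: elements which are central modulo the kernel of an extreme trace act by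
scalars. -/
theorem map_add_eq_mul_of_mem_extremePoints [LieRing.IsNilpotent L] (hA : IsAdjointFamily k A)
    (he : IsAdaptedChart k A e) (hf : f ∈ (chartTraces A e).extremePoints ℝ) {I : LieIdeal k L}
    (hI : ∀ V ∈ I, f V = 1) (X : L) {Z : L} (hZ : Z ∈ I.normalizer) : f (X + Z) = f X * f Z := by
  have hinv : ∀ X, ∀ V ∈ I, f (X + V) = f X := fun X V hV => map_add_of_eq_one he hf.1 hI X hV
  have hmul : ∀ W ∈ I.normalizer, ∀ X, (f ∘ e.symm) (e X * e W) = f (X + W) := by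
    intro W hW X
    obtain ⟨a, ha, h⟩ := he.exists_mul I X hW
    rw [h, Function.comp_apply, e.symm_apply_apply, hinv _ _ ha]
  have hAd : ∀ W ∈ I.normalizer, ∀ g X, f (A g X + W) = f (X + W) := by
    intro W hW g X
    rw [← hinv (A g X + W) _ (hA.sub_mem g I W hW), ← hf.1.2.1 g (X + W), hA.map_add]
    congr 1
    abel
  have hZ' : -Z ∈ I.normalizer := neg_mem hZ
  -- `4 f` is the sum of two invariant functions of positive type, for each `c` on the unit circle;
  -- the values `1` and `I` of `c` then determine `f (X + Z)`
  have hsc : ∀ c : ℂ, c * conj c = 1 →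
      2 * f X + c * f (X + Z) + conj c * f (X + -Z) =
        (2 * f 0 + c * f (0 + Z) + conj c * f (0 + -Z)) * f X := by
    intro c hc
    have hpos : ∀ d : ℂ, d * conj d = 1 → IsPositiveType
        ((fun X => 2 * f X + d * f (X + Z) + conj d * f (X + -Z)) ∘ e.symm) := by
      intro d hd
      convert hf.1.1.twist (map_mul_comm_of_invariant he hf.1.2.1) (e Z) hd using 1
      funext x
      obtain ⟨Y, rfl⟩ := e.surjective x
      rw [← he.map_neg, hmul Z hZ, hmul (-Z) hZ']
      simp
    refine eq_smul_of_mem_extremePoints he hf (hpos c hc) (hpos (-c) (by simpa using hc))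
      (fun g Y => by simp only [hf.1.2.1, hAd Z hZ, hAd (-Z) hZ'])
      (fun g Y => by simp only [hf.1.2.1, hAd Z hZ, hAd (-Z) hZ']) (fun Y => ?_) X
    simp only [_root_.map_neg]
    ring
  have h1 := hsc 1 (by simp)
  have hI := hsc Complex.I (by simp)
  simp only [map_one, Complex.conj_I, zero_add, hf.1.2.2] at h1 hI
  have hI2 := Complex.I_mul_I
  linear_combination h1 / 2 - Complex.I / 2 * hI +
    (f (X + Z) / 2 - f (X + -Z) / 2 - f X * f Z / 2 + f X * f (-Z) / 2) * hI2

/-- If `I` is a maximal ideal among those on which the extreme trace `f` is `1`, then `f` vanishes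
on the elements of the second step of the upper central series of `L / I` which are not in the first
step: otherwise `f` is also `1` on the ideal `I + ⁅X, L⁆`. -/
theorem eq_zero_of_mem_normalizer_normalizer [LieRing.IsNilpotent L] (hA : IsAdjointFamily k A)
    (he : IsAdaptedChart k A e) (hf : f ∈ (chartTraces A e).extremePoints ℝ) {I : LieIdeal k L}
    (hI : ∀ V ∈ I, f V = 1) (hmax : ∀ J : LieIdeal k L, I ≤ J → (∀ V ∈ J, f V = 1) → J ≤ I)
    {X : L} (hX : X ∈ I.normalizer.normalizer) (hX' : X ∉ I.normalizer) : f X = 0 := by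
  by_contra hne
  have hinv : ∀ X, ∀ V ∈ I, f (X + V) = f X := fun X V hV => map_add_of_eq_one he hf.1 hI X hV
  have hlie : ∀ Y : L, ⁅Y, X⁆ ∈ I.normalizer := (LieSubmodule.mem_normalizer _ X).mp hX
  have hlie' : ∀ Y : L, ⁅X, Y⁆ ∈ I.normalizer := fun Y => by
    rw [← lie_skew]
    exact neg_mem (hlie Y)
  have h1 : ∀ Y : L, f ⁅Y, X⁆ = 1 := by
    intro Y
    obtain ⟨g, hg⟩ := hA.exists_sub_mem Y
    have h := hf.1.2.1 g X
    rw [show A g X = X + ⁅Y, X⁆ + (A g X - X - ⁅Y, X⁆) by abel, hinv _ _ (hg I X hX),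
      map_add_eq_mul_of_mem_extremePoints hA he hf hI X (hlie Y)] at h
    exact mul_left_cancel₀ hne (h.trans (mul_one _).symm)
  let J : LieIdeal k L :=
    { toSubmodule := I.toSubmodule ⊔ LinearMap.range (LieAlgebra.ad k L X)
      lie_mem := by
        intro y m hm
        obtain ⟨v, hv, w, ⟨Y, rfl⟩, rfl⟩ := Submodule.mem_sup.mp hm
        refine Submodule.mem_sup_left ?_
        rw [lie_add]
        exact add_mem (I.lie_mem hv) ((LieSubmodule.mem_normalizer _ _).mp (hlie' Y) y) }
  have hIJ : I ≤ J := fun v hv => Submodule.mem_sup_left (S := I.toSubmodule) hv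
  have hJ : J ≤ I := by
    refine hmax J hIJ fun V hV => ?_
    obtain ⟨v, hv, w, ⟨Y, rfl⟩, rfl⟩ := Submodule.mem_sup.mp hV
    rw [add_comm, hinv _ _ hv, LieAlgebra.ad_apply, ← lie_skew, ← neg_lie]
    exact h1 _
  refine hX' ((LieSubmodule.mem_normalizer _ X).mpr fun Y => ?_)
  rw [← lie_skew]
  exact neg_mem (hJ (Submodule.mem_sup_right (S := I.toSubmodule)
    (LinearMap.mem_range_self (LieAlgebra.ad k L X) Y)))

/-- The vanishing of a trace propagates upwards along the upper central series. An element `X` whose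
bracket with `Y` is not in `I` has the conjugates `Ad(exp (m Y)) X`, `m ∈ ℕ`; they are pairwise
orthogonal, and Bessel's inequality applies. -/
theorem eq_zero_of_vanishing_on_normalizer [CharZero k] [LieRing.IsNilpotent L]
    (hA : IsAdjointFamily k A) (he : IsAdaptedChart k A e) (hf : f ∈ chartTraces A e)
    {I : LieIdeal k L} (hI : ∀ V ∈ I.normalizer, V ∉ I → f V = 0)
    {X : L} (hX : X ∈ I.normalizer.normalizer) (hX' : X ∉ I.normalizer) : f X = 0 := by
  obtain ⟨Y, hY⟩ : ∃ Y : L, ⁅Y, X⁆ ∉ I := by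
    by_contra! h
    exact hX' ((LieSubmodule.mem_normalizer _ X).mpr h)
  have hYn : ⁅Y, X⁆ ∈ I.normalizer := (LieSubmodule.mem_normalizer _ X).mp hX Y
  choose g hg using fun m : ℕ => hA.exists_sub_mem ((m : k) • Y)
  have h1 : (f ∘ e.symm) 1 = 1 := by
    rw [← he.map_zero]
    simpa using hf.2.2
  refine hf.1.eq_zero_of_orthogonal h1 (fun m => e (A (g m) X)) (fun m => ?_) fun m l hml => ?_
  · simp [hf.2.1]
  have hV : A (g l) X - A (g m) X - ((l : k) - m) • ⁅Y, X⁆ ∈ I := by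
    convert sub_mem (hg l I X hX) (hg m I X hX) using 1
    rw [smul_lie, smul_lie, sub_smul]
    abel
  set V := A (g l) X - A (g m) X
  have hVn : V ∈ I.normalizer := by
    rw [← sub_add_cancel V (((l : k) - m) • ⁅Y, X⁆)]
    exact add_mem (I.le_normalizer hV) (I.normalizer.smul_mem _ hYn)
  obtain ⟨a, ha, h⟩ := he.exists_add_of_mem_normalizer I (A (g m) X) hVn
  have h2 : (e (A (g m) X))⁻¹ * e (A (g l) X) = e (V + a) := by
    rw [inv_mul_eq_iff_eq_mul, ← h]
    simp [V]
  rw [h2, Function.comp_apply, e.symm_apply_apply]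
  refine hI _ (add_mem hVn (I.le_normalizer ha)) fun hmem => hY ?_
  have hne : (l : k) - m ≠ 0 := sub_ne_zero.mpr (by exact_mod_cast hml.symm)
  have h3 : ((l : k) - m) • ⁅Y, X⁆ ∈ I := by
    have := sub_mem (sub_mem hmem ha) hV
    rwa [add_sub_cancel_right, sub_sub_cancel] at this
  simpa [smul_smul, inv_mul_cancel₀ hne] using I.smul_mem ((l : k) - m)⁻¹ h3

/-- An extreme trace is the trivial extension of a unitary character of the additive group of an
ideal which is central modulo an ideal on which this character is trivial. -/
theorem exists_lieIdeal_of_mem_extremePoints [CharZero k] [LieRing.IsNilpotent L]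
    [IsNoetherian k L] (hA : IsAdjointFamily k A) (he : IsAdaptedChart k A e)
    (hf : f ∈ (chartTraces A e).extremePoints ℝ) :
    ∃ I : LieIdeal k L, (∀ X, ∀ V ∈ I, f (X + V) = f X) ∧ (∀ X ∉ I.normalizer, f X = 0) ∧
      ∀ X, ∀ Z ∈ I.normalizer, f (X + Z) = f X * f Z := by
  have hbot : ∀ V ∈ (⊥ : LieIdeal k L), f V = 1 := fun V hV => by
    rw [(LieSubmodule.mem_bot V).mp hV]
    exact hf.1.2.2
  obtain ⟨I, hI, hmax⟩ := WellFounded.has_min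
    (wellFounded_gt (α := LieIdeal k L)) {I | ∀ V ∈ I, f V = 1} ⟨⊥, hbot⟩
  have hmax' : ∀ J : LieIdeal k L, I ≤ J → (∀ V ∈ J, f V = 1) → J ≤ I := fun J hIJ hJ => by
    by_contra h
    exact hmax J hJ (lt_of_le_not_ge hIJ h)
  refine ⟨I, fun X V hV => map_add_of_eq_one he hf.1 hI X hV, ?_,
    fun X Z hZ => map_add_eq_mul_of_mem_extremePoints hA he hf hI X hZ⟩
  have hle : ∀ n, I ≤ I.ucs n := by
    intro n
    induction n with
    | zero => exact le_rfl
    | succ n ih =>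
      rw [LieSubmodule.ucs_succ]
      exact ih.trans (LieSubmodule.le_normalizer _)
  have key : ∀ n : ℕ, ∀ X ∈ I.ucs (n + 1), X ∉ I.normalizer → f X = 0 := by
    intro n
    induction n with
    | zero => exact fun X hX hX' => absurd hX hX'
    | succ n ih =>
      intro X hX hX'
      by_cases hXn : X ∈ I.ucs (n + 1)
      · exact ih X hXn hX'
      cases n with
      | zero => exact eq_zero_of_mem_normalizer_normalizer hA he hf hI hmax' hX hX'
      | succ n =>
        rw [LieSubmodule.ucs_succ, LieSubmodule.ucs_succ] at hX
        rw [LieSubmodule.ucs_succ] at hXn ih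
        refine eq_zero_of_vanishing_on_normalizer hA he hf.1 (fun V hV hV' => ?_) hX hXn
        have hle' : I.normalizer ≤ I.ucs (n + 1) := by
          rw [LieSubmodule.ucs_succ]
          exact LieSubmodule.normalizer_mono (hle n)
        exact ih V hV fun h => hV' (hle' h)
  obtain ⟨n, hn⟩ := (LieModule.isNilpotent_iff_exists_ucs_eq_top (R := k) (L := L) (M := L)).mp ‹_›
  have htop : I.ucs (n + 1) = ⊤ := by
    rw [LieSubmodule.ucs_succ, eq_top_iff, ← hn]
    exact (LieSubmodule.ucs_mono n bot_le).trans (LieSubmodule.le_normalizer _)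
  exact fun X hX => key n X (htop ▸ LieSubmodule.mem_top X) hX

/-- The traces in one chart are traces in every other chart: by the Krein–Milman theorem this has to
be checked for extreme traces only. -/
theorem chartTraces_subset [CharZero k] [LieRing.IsNilpotent L] [IsNoetherian k L]
    {Γ' : Type*} [Group Γ'] {e' : L ≃ Γ'} (hA : IsAdjointFamily k A) (he : IsAdaptedChart k A e)
    (he' : IsAdaptedChart k A e') : chartTraces A e ⊆ chartTraces A e' := by
  rw [← closure_convexHull_extremePoints (isCompact_chartTraces he) convex_chartTraces]
  refine closure_minimal (convexHull_min (fun f hf => ?_) convex_chartTraces)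
    (isCompact_chartTraces he').isClosed
  obtain ⟨I, hinv, hzero, hmul⟩ := exists_lieIdeal_of_mem_extremePoints hA he hf
  refine ⟨?_, hf.1.2⟩
  have hprod : ∀ X, ∀ Y ∈ I.normalizer, e'.symm (e' X * e' Y) - (X + Y) ∈ I := fun X Y hY => by
    rw [← sub_sub]
    exact he'.mul_mem I X Y hY
  let H : Subgroup Γ' :=
    { carrier := {x | e'.symm x ∈ I.normalizer}
      one_mem' := by
        rw [← he'.map_zero]
        simp
      mul_mem' := by
        intro x y hx hy
        have h := hprod (e'.symm x) _ hy
        rw [e'.apply_symm_apply, e'.apply_symm_apply] at h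
        have := add_mem (I.le_normalizer h) (add_mem hx hy)
        rwa [sub_add_cancel] at this
      inv_mem' := by
        intro x hx
        have h := he'.map_neg (e'.symm x)
        rw [e'.apply_symm_apply] at h
        change e'.symm x⁻¹ ∈ I.normalizer
        rw [← h, e'.symm_apply_apply]
        exact neg_mem hx }
  refine isPositiveType_of_subgroup H (fun x hx => hzero _ hx) (fun x _ y hy => ?_) fun x _ => ?_
  · have h := hprod (e'.symm x) _ hy
    rw [e'.apply_symm_apply, e'.apply_symm_apply] at h
    have h2 := hinv (e'.symm x + e'.symm y) _ h
    rw [add_sub_cancel] at h2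
    rw [Function.comp_apply, h2, hmul _ _ hy]
    rfl
  · have h := hf.1.1.map_inv (e (e'.symm x))
    rw [← he.map_neg] at h
    have h' := he'.map_neg (e'.symm x)
    rw [e'.apply_symm_apply] at h'
    rw [← h']
    simpa using h

end Invariance

end Charts

/-! ### The exponential of nilpotent elements of an associative algebra -/

section NilpotentExp

attribute [local instance 100] LieRing.ofAssociativeRing

open Polynomial Finset
open IsNilpotent (exp exp_eq_sum)

variable {A : Type*} [Ring A] [Algebra ℚ A]

/-- The exponential series with its first two terms split off. -/
theorem exists_exp_eq_one_add_add {j : ℕ} {M : A} (hM : M ^ (j + 2) = 0) :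
    ∃ r : ℚ[X], exp M = 1 + M + M ^ 2 * aeval M r := by
  refine ⟨∑ i ∈ range j, C ((i + 2).factorial : ℚ)⁻¹ * X ^ i, ?_⟩
  rw [exp_eq_sum hM, sum_range_succ', sum_range_succ', map_sum, mul_sum]
  simp only [map_mul, map_pow, aeval_C, aeval_X, ← Algebra.smul_def, mul_smul_comm, ← pow_add]
  simp only [add_comm 2, zero_add, Nat.factorial_zero, Nat.factorial_one, Nat.cast_one, inv_one,
    pow_zero, pow_one, one_smul]
  rw [add_assoc, add_comm, add_comm M]

theorem commute_aeval {a b : A} (h : Commute a b) (p : ℚ[X]) : Commute a (aeval b p) :=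
  Algebra.commute_of_mem_adjoin_singleton_of_commute (aeval_mem_adjoin_singleton ℚ b) h

theorem commute_exp {a b : A} (h : Commute a b) : Commute a (exp b) :=
  Commute.sum_right _ _ _ fun i _ => (h.pow_right i).smul_right _

theorem pow_mul_aeval_eq_zero {N : A} {i j : ℕ} (hN : N ^ i = 0) {l : ℕ} (h : i ≤ l * j)
    (s : ℚ[X]) : (N ^ l * aeval N s) ^ j = 0 := by
  rw [((commute_aeval (Commute.refl N) s).pow_left l).mul_pow, ← pow_mul,
    pow_eq_zero_of_le h hN, zero_mul]

/-- Existence of logarithms. One has `(1 + N) exp (-N) = 1 + N'` with `N'` divisible by `N ^ 2`, and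
this may be iterated. -/
theorem exists_exp_mul_aeval_eq {N : A} (hN : IsNilpotent N) :
    ∃ p : ℚ[X], exp (N * aeval N p) = 1 + N := by
  obtain ⟨j, hj⟩ := hN
  induction j using Nat.strong_induction_on generalizing N with
  | _ j ih =>
    rcases lt_or_ge j 2 with hj2 | hj2
    · have hN0 : N = 0 := by simpa using pow_eq_zero_of_le (n := 1) (by omega) hj
      exact ⟨0, by simp [hN0]⟩
    obtain ⟨j, rfl⟩ := Nat.exists_eq_add_of_le' hj2
    have hneg : (-N) ^ (j + 2) = 0 := by rw [neg_pow, hj, mul_zero]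
    obtain ⟨r, hr⟩ := exists_exp_eq_one_add_add hneg
    have hr' : aeval (-N) r = aeval N (r.comp (-X)) := by simp [aeval_comp]
    let s : ℚ[X] := -1 + (1 + X) * r.comp (-X)
    have h1 : (1 + N) * exp (-N) = 1 + N ^ 2 * aeval N s := by
      rw [hr, hr']
      simp only [s, map_add, map_neg, map_one, map_mul, aeval_X]
      rw [neg_sq]
      simp only [mul_add, add_mul, one_mul, mul_one, ← mul_assoc, mul_neg, sq]
      abel
    obtain ⟨q, hq⟩ := ih (j + 1) (by omega)
      (pow_mul_aeval_eq_zero (l := 2) (j := j + 1) hj (by omega) s)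
    have hcomm : Commute N (N ^ 2 * aeval N s) :=
      (Commute.self_pow N 2).mul_right (commute_aeval (Commute.refl N) s)
    have hcomm' := hcomm.mul_right (commute_aeval hcomm q)
    have hnil : IsNilpotent N := ⟨_, hj⟩
    have hnil' : IsNilpotent (N ^ 2 * aeval N s) :=
      ⟨j + 1, pow_mul_aeval_eq_zero (l := 2) (j := j + 1) hj (by omega) s⟩
    refine ⟨1 + X * s * q.comp (X ^ 2 * s), ?_⟩
    have e : N * aeval N (1 + X * s * q.comp (X ^ 2 * s)) =
        N + N ^ 2 * aeval N s * aeval (N ^ 2 * aeval N s) q := by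
      simp [aeval_comp, mul_add, sq, mul_assoc]
    rw [e, IsNilpotent.exp_add_of_commute hcomm' hnil
      ((commute_aeval (Commute.refl _) q).isNilpotent_mul_right hnil'), hq, ← h1, ← mul_assoc,
      ((Commute.one_right (exp N)).add_right (commute_exp (Commute.refl N)).symm).eq, mul_assoc,
      IsNilpotent.exp_mul_exp_neg_self hnil, mul_one]

theorem eq_zero_of_exp_eq_one {M : A} (hM : IsNilpotent M) (h : exp M = 1) : M = 0 := by
  obtain ⟨j, hj⟩ := hM
  obtain ⟨r, hr⟩ := exists_exp_eq_one_add_add (pow_eq_zero_of_le (Nat.le_add_right j 2) hj)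
  have hc : Commute M (aeval M r) := commute_aeval (Commute.refl M) r
  have hu := (hc.isNilpotent_mul_right ⟨j, hj⟩).isUnit_one_add
  rw [h, add_assoc, left_eq_add] at hr
  rw [← hu.mul_left_eq_zero, mul_add, mul_one, ← mul_assoc, ← sq, hr]

/-- The logarithm is a polynomial in `exp X`, hence commutes with `X`; this reduces the injectivity
of the exponential map to its triviality on the fibre of `1`. -/
theorem exp_injective {X Y : A} (hX : IsNilpotent X) (hY : IsNilpotent Y) (h : exp X = exp Y) :
    X = Y := by
  have hN := IsNilpotent.isNilpotent_exp_sub_one hX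
  obtain ⟨p, hp⟩ := exists_exp_mul_aeval_eq hN
  set Z := (exp X - 1) * aeval (exp X - 1) p
  have hZ : IsNilpotent Z := (commute_aeval (Commute.refl _) p).isNilpotent_mul_right hN
  have key : ∀ {X' : A}, IsNilpotent X' → exp X' = exp X → X' = Z := by
    intro X' hX' h'
    have hc : Commute X' (exp X - 1) := by
      rw [← h']
      exact (commute_exp (Commute.refl X')).sub_right (Commute.one_right X')
    have hc' : Commute X' Z := hc.mul_right (commute_aeval hc p)
    rw [← sub_eq_zero]
    refine eq_zero_of_exp_eq_one (hc'.isNilpotent_sub hX' hZ) ?_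
    rw [sub_eq_add_neg, IsNilpotent.exp_add_of_commute hc'.neg_right hX' hZ.neg, h',
      show exp X = exp Z by rw [hp]; abel, IsNilpotent.exp_mul_exp_neg_self hZ]
  rw [key hX rfl, key hY h.symm]

/-- `exp(Y) X exp(-Y) = exp(ad Y) X`. -/
theorem exp_mul_mul_exp_neg {Y : A} (hY : IsNilpotent Y) (X : A) {m : ℕ}
    (hm : LieAlgebra.ad ℚ A Y ^ m = 0) :
    exp Y * X * exp (-Y) =
      ∑ i ∈ range m, (i.factorial : ℚ)⁻¹ • (LieAlgebra.ad ℚ A Y ^ i) X := by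
  have hl : exp (LinearMap.mulLeft ℚ Y) = LinearMap.mulLeft ℚ (exp Y) :=
    (IsNilpotent.map_exp hY (Algebra.lmul ℚ A)).symm
  have hr : exp (LinearMap.mulRight ℚ (-Y)) = LinearMap.mulRight ℚ (exp (-Y)) := by
    obtain ⟨l, hl⟩ := hY.neg
    ext a
    rw [exp_eq_sum hl, exp_eq_sum (k := l) (by rw [LinearMap.pow_mulRight, hl]; ext; simp)]
    simp [LinearMap.pow_mulRight, mul_sum, LinearMap.sum_apply]
  have had : LieAlgebra.ad ℚ A Y = LinearMap.mulLeft ℚ Y + LinearMap.mulRight ℚ (-Y) := by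
    ext a
    simp [Ring.lie_def, sub_eq_add_neg]
  have h := congrArg (fun f => f X) (exp_eq_sum hm)
  simp only [LinearMap.sum_apply, LinearMap.smul_apply] at h
  rw [← h, had, IsNilpotent.exp_add_of_commute (LinearMap.commute_mulLeft_right Y (-Y)), hl, hr]
  · simp [mul_assoc]
  · obtain ⟨l, hl⟩ := hY
    exact ⟨l, by rw [LinearMap.pow_mulLeft, hl]; ext; simp⟩
  · obtain ⟨l, hl⟩ := hY.neg
    exact ⟨l, by rw [LinearMap.pow_mulRight, hl]; ext; simp⟩

/-- The logarithmic derivative of `exp W`. It is obtained by writing `exp(-W) ∘ D ∘ exp(W)`, in the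
algebra of linear endomorphisms, as `exp(-ad W) D`. -/
theorem exists_exp_neg_mul_derivation_exp (D : A →ₗ[ℚ] A)
    (hD : ∀ a b, D (a * b) = D a * b + a * D b) {W : A} (hW : IsNilpotent W) :
    ∃ m : ℕ, exp (-W) * D (exp W) =
      ∑ i ∈ range (m + 1), ((i + 1).factorial : ℚ)⁻¹ • (LieAlgebra.ad ℚ A (-W) ^ i) (D W) := by
  have hY : IsNilpotent (LinearMap.mulLeft ℚ (-W)) := by
    obtain ⟨l, hl⟩ := hW.neg
    exact ⟨l, by rw [LinearMap.pow_mulLeft, hl]; ext; simp⟩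
  have hD1 : D 1 = 0 := by simpa using hD 1 1
  have hpow : ∀ i : ℕ, (LieAlgebra.ad ℚ (Module.End ℚ A) (LinearMap.mulLeft ℚ (-W)) ^ (i + 1)) D =
      LinearMap.mulLeft ℚ ((LieAlgebra.ad ℚ A (-W) ^ i) (D W)) := by
    intro i
    induction i with
    | zero =>
      ext a
      simp [Ring.lie_def, hD]
    | succ i ih =>
      rw [pow_succ', Module.End.mul_apply, ih, pow_succ', Module.End.mul_apply]
      ext a
      simp [Ring.lie_def, mul_assoc, sub_mul]
      abel
  obtain ⟨m, hm⟩ := LieAlgebra.ad_nilpotent_of_nilpotent (R := ℚ) hY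
  refine ⟨m, ?_⟩
  have h := exp_mul_mul_exp_neg hY D (m := m + 2) (pow_eq_zero_of_le (by omega) hm)
  have hl : ∀ {V : A}, IsNilpotent V → exp (LinearMap.mulLeft ℚ V) = LinearMap.mulLeft ℚ (exp V) :=
    fun hV => (IsNilpotent.map_exp hV (Algebra.lmul ℚ A)).symm
  have hneg : -LinearMap.mulLeft ℚ (-W) = LinearMap.mulLeft ℚ W := by
    ext
    simp
  rw [hneg, hl hW, hl hW.neg, sum_range_succ'] at h
  have h := congrArg (fun f => f 1) h
  simp only [hpow] at h
  simpa [LinearMap.sum_apply, hD1] using h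

end NilpotentExp

/-! ### Strictly upper triangular matrices over a commutative ring -/

section StrictlyUpper

open Polynomial Finset
open IsNilpotent (exp)

variable {R : Type*} [CommRing R] [Algebra ℚ R] {n : ℕ}

variable (R n) in
/-- The strictly upper triangular matrices over a commutative ring, as a non-unital subalgebra. In
contrast to `IsStrictlyUpper`, the ring need not be a field: matrices over `k[X]` occur as curves of
matrices over `k`. -/
def strictlyUpper : NonUnitalSubalgebra ℚ (Matrix (Fin n) (Fin n) R) where
  carrier := {M | ∀ i j, j ≤ i → M i j = 0}
  add_mem' := by
    intro M N hM hN i j h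
    simp [hM i j h, hN i j h]
  zero_mem' := fun _ _ _ => rfl
  mul_mem' := by
    intro M N hM hN i j h
    rw [Matrix.mul_apply]
    refine Finset.sum_eq_zero fun l _ => ?_
    rcases le_or_gt l i with hl | hl
    · rw [hM i l hl, zero_mul]
    · rw [hN l j (h.trans hl.le), mul_zero]
  smul_mem' := by
    intro c M hM i j h
    simp [hM i j h]

theorem isNilpotent_of_mem_strictlyUpper {M : Matrix (Fin n) (Fin n) R}
    (hM : M ∈ strictlyUpper R n) : IsNilpotent M := by
  refine ⟨n, ?_⟩
  have h1 : M.charpoly = Polynomial.X ^ n := by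
    rw [Matrix.charpoly_of_isUpperTriangular M (fun i j h => hM i j (le_of_lt h))]
    simp [hM _ _ le_rfl]
  simpa [h1] using Matrix.aeval_self_charpoly M

theorem mul_aeval_mem {A : Type*} [Ring A] [Algebra ℚ A] (S : NonUnitalSubalgebra ℚ A) {N : A}
    (hN : N ∈ S) (p : ℚ[X]) : N * aeval N p ∈ S := by
  have hpow : ∀ i : ℕ, N ^ (i + 1) ∈ S := by
    intro i
    induction i with
    | zero => simpa using hN
    | succ i ih => exact pow_succ N (i + 1) ▸ S.mul_mem ih hN
  induction p using Polynomial.induction_on' with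
  | add p q hp hq => rw [map_add, mul_add]; exact S.add_mem hp hq
  | monomial i a =>
    rw [aeval_monomial, ← Algebra.smul_def, mul_smul_comm, ← pow_succ']
    exact S.smul_mem a (hpow i)

theorem exp_sub_one_mem_strictlyUpper {M : Matrix (Fin n) (Fin n) R}
    (hM : M ∈ strictlyUpper R n) : exp M - 1 ∈ strictlyUpper R n := by
  obtain ⟨j, hj⟩ := isNilpotent_of_mem_strictlyUpper hM
  obtain ⟨r, hr⟩ := exists_exp_eq_one_add_add (pow_eq_zero_of_le (Nat.le_add_right j 2) hj)
  have h : exp M - 1 = M * aeval M (1 + X * r) := by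
    rw [hr]
    simp [mul_add, sq, mul_assoc, add_assoc]
  rw [h]
  exact mul_aeval_mem _ hM _

theorem exists_exp_eq_of_sub_one_mem_strictlyUpper {M : Matrix (Fin n) (Fin n) R}
    (hM : M - 1 ∈ strictlyUpper R n) : ∃ W ∈ strictlyUpper R n, exp W = M := by
  obtain ⟨p, hp⟩ := exists_exp_mul_aeval_eq (isNilpotent_of_mem_strictlyUpper hM)
  exact ⟨_, mul_aeval_mem _ hM p, by rw [hp]; abel⟩

theorem exists_exp_eq_exp_mul_exp {M N : Matrix (Fin n) (Fin n) R} (hM : M ∈ strictlyUpper R n)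
    (hN : N ∈ strictlyUpper R n) : ∃ W ∈ strictlyUpper R n, exp W = exp M * exp N := by
  refine exists_exp_eq_of_sub_one_mem_strictlyUpper ?_
  have hM' := exp_sub_one_mem_strictlyUpper hM
  have hN' := exp_sub_one_mem_strictlyUpper hN
  have h : exp M * exp N - 1 = (exp M - 1) * (exp N - 1) + (exp M - 1) + (exp N - 1) := by
    noncomm_ring
  rw [h]
  exact add_mem (add_mem (mul_mem hM' hN') hM') hN'

end StrictlyUpper

/-! ### Polynomial curves of matrices and the Campbell–Hausdorff product -/

section Curves

attribute [local instance 100] LieRing.ofAssociativeRing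

open Polynomial Finset
open IsNilpotent (exp)

variable {k : Type*} [Field k] {n : ℕ}

/-- The point with parameter `t` of a polynomial curve of matrices. -/
noncomputable def evalCurve (t : k) : Matrix (Fin n) (Fin n) k[X] →+* Matrix (Fin n) (Fin n) k :=
  (evalRingHom t).mapMatrix

/-- The constant curve. -/
noncomputable def constCurve : Matrix (Fin n) (Fin n) k →+* Matrix (Fin n) (Fin n) k[X] :=
  C.mapMatrix

theorem evalCurve_constCurve (t : k) (M : Matrix (Fin n) (Fin n) k) :
    evalCurve t (constCurve M) = M := by
  ext
  simp [evalCurve, constCurve]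

variable [CharZero k]

/-- Entrywise differentiation of polynomial curves of matrices. -/
noncomputable def derivCurve :
    Matrix (Fin n) (Fin n) k[X] →ₗ[ℚ] Matrix (Fin n) (Fin n) k[X] where
  toFun W := W.map derivative
  map_add' V W := by ext1; simp
  map_smul' c W := by ext1 i j; simp

theorem derivCurve_mul (V W : Matrix (Fin n) (Fin n) k[X]) :
    derivCurve (V * W) = derivCurve V * W + V * derivCurve W := by
  ext1 i j
  simp [derivCurve, Matrix.mul_apply, sum_add_distrib]

theorem evalCurve_ad (t : k) (V W : Matrix (Fin n) (Fin n) k[X]) (i : ℕ) :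
    evalCurve t ((LieAlgebra.ad ℚ _ V ^ i) W) =
      (LieAlgebra.ad ℚ _ (evalCurve t V) ^ i) (evalCurve t W) := by
  induction i with
  | zero => simp
  | succ i ih =>
    rw [pow_succ', Module.End.mul_apply, pow_succ', Module.End.mul_apply, ← ih]
    simp [Ring.lie_def]

/-- A curve with velocities in the affine space `Y + 𝔞` has its displacement in `Y + 𝔞`. -/
theorem evalCurve_one_sub_evalCurve_zero_sub_mem (𝔞 : Submodule k (Matrix (Fin n) (Fin n) k))
    (W : Matrix (Fin n) (Fin n) k[X]) (Y : Matrix (Fin n) (Fin n) k)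
    (h : ∀ t, evalCurve t (derivCurve W) - Y ∈ 𝔞) :
    evalCurve 1 W - evalCurve 0 W - Y ∈ 𝔞 := by
  by_contra hmem
  obtain ⟨l, hl, hle⟩ := Submodule.exists_le_ker_of_notMem hmem
  have hl' : ∀ M, l M = ∑ i, ∑ j, l (Matrix.single i j 1) * M i j := by
    intro M
    conv_lhs => rw [Matrix.matrix_eq_sum_single M]
    simp only [map_sum]
    refine sum_congr rfl fun i _ => sum_congr rfl fun j _ => ?_
    rw [show Matrix.single i j (M i j) = M i j • Matrix.single i j (1 : k) by simp, map_smul,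
      smul_eq_mul, mul_comm]
  -- `l (W(t) - t Y)` as a polynomial in `t`
  let q : k[X] := ∑ i, ∑ j, C (l (Matrix.single i j 1)) * W i j - C (l Y) * X
  have hq : ∀ t, q.eval t = l (evalCurve t W) - l Y * t := by
    intro t
    rw [hl' (evalCurve t W)]
    simp [q, eval_finsetSum, evalCurve]
  have hq' : derivative q = 0 := by
    refine Polynomial.funext fun t => ?_
    have h0 := hle (h t)
    rw [LinearMap.mem_ker, map_sub, hl' (evalCurve t _)] at h0
    simpa [q, eval_finsetSum, evalCurve, derivCurve] using h0
  have h1 := hq 1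
  have h0 := hq 0
  rw [eq_C_of_derivative_eq_zero hq', eval_C] at h1 h0
  refine hl ?_
  rw [map_sub, map_sub]
  linear_combination h0 - h1

/-- Inversion of a power series in a nilpotent endomorphism, modulo an invariant subspace. -/
theorem sub_mem_of_eq_sum {B : Type*} [AddCommGroup B] [Module ℚ B] {g : Module.End ℚ B}
    (hg : IsNilpotent g) (S : Submodule ℚ B) (hS : ∀ x ∈ S, g x ∈ S) {d y : B} (hy : g y ∈ S)
    {c : ℕ → ℚ} (hc : c 0 = 1) {m : ℕ} (h : y = ∑ i ∈ range (m + 1), c i • (g ^ i) d) :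
    d - y ∈ S := by
  obtain ⟨N, hN⟩ := hg
  rw [sum_range_succ', hc, one_smul, pow_zero, Module.End.one_apply] at h
  have hpow : ∀ j, (g ^ (j + 1)) y ∈ S := by
    intro j
    induction j with
    | zero => simpa using hy
    | succ j ih => rw [pow_succ', Module.End.mul_apply]; exact hS _ ih
  -- descending induction on the exponent of `g`
  have key : ∀ r j, N ≤ j + r → (g ^ (j + 1)) d ∈ S := by
    intro r
    induction r with
    | zero =>
      intro j hj
      rw [pow_eq_zero_of_le (by omega) hN]
      exact S.zero_mem
    | succ r ih =>
      intro j hj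
      have e : (g ^ (j + 1)) d = (g ^ (j + 1)) y -
          ∑ i ∈ range m, c (i + 1) • (g ^ (j + 1 + i + 1)) d := by
        conv_rhs => rw [h]
        simp only [map_add, map_sum, map_smul, ← Module.End.mul_apply, ← pow_add, ← add_assoc]
        abel
      rw [e]
      exact S.sub_mem (hpow j) (S.sum_mem fun i _ => S.smul_mem _ (ih _ (by omega)))
  rw [h, show ∀ s : B, d - (s + d) = -s by intro s; abel]
  exact S.neg_mem (S.sum_mem fun i _ => S.smul_mem _ (key N i (by omega)))

/-- If `Y` is central modulo `𝔞`, then `log (exp X exp Y)` is `X + Y` modulo `𝔞`. Here `𝔤` is any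
subspace which contains the curve `log (exp X exp (t Y))` and normalizes `𝔞`: by the formula for the
derivative of the exponential, this curve has velocity `Y` modulo `𝔞`. -/
theorem log_exp_mul_exp_sub_mem {X Y W : Matrix (Fin n) (Fin n) k}
    (𝔤 𝔞 : Submodule k (Matrix (Fin n) (Fin n) k))
    (hX : X ∈ strictlyUpper k n) (hY : Y ∈ strictlyUpper k n) (hW : W ∈ strictlyUpper k n)
    (h𝔤 : ∀ (t : k), ∀ V ∈ strictlyUpper k n, exp V = exp X * exp (t • Y) → V ∈ 𝔤)
    (h𝔞 : ∀ V ∈ 𝔤, ∀ a ∈ 𝔞, ⁅V, a⁆ ∈ 𝔞) (hY𝔞 : ∀ V ∈ 𝔤, ⁅V, Y⁆ ∈ 𝔞)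
    (h : exp W = exp X * exp Y) : W - X - Y ∈ 𝔞 := by
  have hXn := isNilpotent_of_mem_strictlyUpper hX
  have hYn := isNilpotent_of_mem_strictlyUpper hY
  have hconst : ∀ M ∈ strictlyUpper k n, constCurve M ∈ strictlyUpper k[X] n :=
    fun M hM i j hij => by simp [constCurve, hM i j hij]
  have heval : ∀ (t : k), ∀ M ∈ strictlyUpper k[X] n, evalCurve t M ∈ strictlyUpper k n :=
    fun t M hM i j hij => by simp [evalCurve, hM i j hij]
  -- the curve `t ↦ t Y`
  set T : Matrix (Fin n) (Fin n) k[X] := (Polynomial.X : k[X]) • constCurve Y with hT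
  have hTmem : T ∈ strictlyUpper k[X] n := fun i j hij => by
    simp [hT, hconst Y hY i j hij]
  have hTt : ∀ t, evalCurve t T = t • Y := fun t => by
    ext
    simp [hT, evalCurve, constCurve]
    ring
  have hTd : derivCurve T = constCurve Y := by
    ext1
    simp [hT, derivCurve, constCurve]
  have hTn := isNilpotent_of_mem_strictlyUpper hTmem
  -- the curve `t ↦ log (exp X exp (t Y))`
  obtain ⟨P, hP, hPexp⟩ := exists_exp_eq_exp_mul_exp (hconst X hX) hTmem
  have hPn := isNilpotent_of_mem_strictlyUpper hP
  have hPt : ∀ t, exp (evalCurve t P) = exp X * exp (t • Y) := fun t => by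
    rw [← IsNilpotent.map_exp hPn, hPexp, map_mul, IsNilpotent.map_exp hTn, hTt,
      IsNilpotent.map_exp (isNilpotent_of_mem_strictlyUpper (hconst X hX)), evalCurve_constCurve]
  -- the logarithmic derivative of `exp P`
  have hTexp : derivCurve (exp T) = exp T * constCurve Y := by
    obtain ⟨m, hm⟩ := exists_exp_neg_mul_derivation_exp derivCurve derivCurve_mul hTn
    have hzero : ∀ i : ℕ, (LieAlgebra.ad ℚ _ (-T) ^ (i + 1)) (constCurve Y) = 0 := by
      intro i
      rw [pow_succ, Module.End.mul_apply]
      simp [hT, Ring.lie_def]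
    rw [sum_range_succ', hTd, sum_eq_zero (fun i _ => by rw [hzero, smul_zero])] at hm
    have h2 := congrArg (fun M => exp T * M) hm
    simpa [← mul_assoc, IsNilpotent.exp_mul_exp_neg_self hTn] using h2
  have hPd : exp (-P) * derivCurve (exp P) = constCurve Y := by
    have hc : derivCurve (exp (constCurve X)) = 0 := by
      rw [← IsNilpotent.map_exp hXn]
      ext1
      simp [derivCurve, constCurve]
    rw [hPexp, derivCurve_mul, hc, zero_mul, zero_add, hTexp, ← mul_assoc (exp (constCurve X)),
      ← hPexp, ← mul_assoc, IsNilpotent.exp_neg_mul_exp_self hPn, one_mul]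
  obtain ⟨m, hm⟩ := exists_exp_neg_mul_derivation_exp derivCurve derivCurve_mul hPn
  rw [hPd] at hm
  have hvel : ∀ t, evalCurve t (derivCurve P) - Y ∈ 𝔞 := by
    intro t
    have hmem : evalCurve t P ∈ 𝔤 := h𝔤 t _ (heval t P hP) (hPt t)
    have hn := (isNilpotent_of_mem_strictlyUpper (heval t P hP)).neg
    have h2 := congrArg (evalCurve t) hm
    simp only [map_sum, map_rat_smul, evalCurve_constCurve, evalCurve_ad,
      map_neg (evalCurve t)] at h2
    refine sub_mem_of_eq_sum (LieAlgebra.ad_nilpotent_of_nilpotent (R := ℚ) hn)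
      (𝔞.restrictScalars ℚ) (fun a ha => ?_) ?_ (c := fun i => ((i + 1).factorial : ℚ)⁻¹)
      (by simp) h2
    · rw [LieAlgebra.ad_apply, neg_lie]
      exact neg_mem (h𝔞 _ hmem a ha)
    · rw [LieAlgebra.ad_apply, neg_lie]
      exact neg_mem (hY𝔞 _ hmem)
  have hfin := evalCurve_one_sub_evalCurve_zero_sub_mem 𝔞 P Y hvel
  have h1 : evalCurve 1 P = W := exp_injective (isNilpotent_of_mem_strictlyUpper (heval 1 P hP))
    (isNilpotent_of_mem_strictlyUpper hW) (by rw [hPt, h, one_smul])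
  have h0 : evalCurve 0 P = X := exp_injective (isNilpotent_of_mem_strictlyUpper (heval 0 P hP))
    hXn (by rw [hPt]; simp)
  rwa [h1, h0] at hfin

end Curves

/-! ### The exponential chart of a unipotent group -/

section UnipotentGroup

attribute [local instance 100] LieRing.ofAssociativeRing

open Finset
open IsNilpotent (exp)

theorem ad_pow_mem {k L : Type*} [Field k] [LieRing L] [LieAlgebra k L] (I : LieIdeal k L)
    (Z : L) {X : L} (hX : X ∈ I) (i : ℕ) : (LieAlgebra.ad k L Z ^ i) X ∈ I := by
  induction i with
  | zero => exact hX
  | succ i ih =>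
    rw [pow_succ', Module.End.mul_apply]
    exact I.lie_mem ih

variable {k : Type*} [Field k] [CharZero k] {n : ℕ}
variable (U : Subgroup (GL (Fin n) k)) (hU : IsUnipotentAlgebraic U)

theorem coe_mem_strictlyUpper (X : lieAlg U hU) :
    (X : Matrix (Fin n) (Fin n) k) ∈ strictlyUpper k n :=
  X.2.1

theorem isNilpotent_coe (X : lieAlg U hU) : IsNilpotent (X : Matrix (Fin n) (Fin n) k) :=
  X.2.1.isNilpotent

instance : LieRing.IsNilpotent (lieAlg U hU) :=
  (LieAlgebra.isNilpotent_iff_forall (R := k)).mpr fun X =>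
    LieAlgebra.isNilpotent_ad_of_isNilpotent (isNilpotent_coe U hU X)

theorem expMap_bijective : Function.Bijective (expMap U hU) := by
  constructor
  · intro X Y h
    refine Subtype.ext (exp_injective (isNilpotent_coe U hU X) (isNilpotent_coe U hU Y) ?_)
    rw [← coe_expMap, ← coe_expMap, h]
  · intro g
    obtain ⟨S, hS⟩ := id hU
    have hg := ((hS g).mp g.2).1
    have hmem : ((g : GL (Fin n) k) : Matrix (Fin n) (Fin n) k) - 1 ∈ strictlyUpper k n := by
      intro i j hij
      rcases hij.eq_or_lt with rfl | hij
      · simp [hg.1]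
      · simp [hg.2 i j hij, Matrix.one_apply_ne hij.ne']
    obtain ⟨W, hW, h⟩ := exists_exp_eq_of_sub_one_mem_strictlyUpper hmem
    refine ⟨⟨W, hW, g, g.2, h.symm⟩, Subtype.ext (Units.ext ?_)⟩
    rw [coe_expMap]
    exact h

/-- The exponential map as a bijection of `𝔲` onto `U`. -/
noncomputable def expEquiv : lieAlg U hU ≃ U :=
  Equiv.ofBijective _ (expMap_bijective U hU)

theorem coe_expEquiv (X : lieAlg U hU) :
    ((expEquiv U hU X : GL (Fin n) k) : Matrix (Fin n) (Fin n) k) =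
      exp (X : Matrix (Fin n) (Fin n) k) :=
  coe_expMap U hU X

/-- `Ad(exp Z)` is given by the exponential series of `ad Z`. -/
theorem exists_Ad_expEquiv_eq (Z X : lieAlg U hU) :
    ∃ m, Ad U hU (expEquiv U hU Z) X = X + ⁅Z, X⁆ + ∑ i ∈ range m,
      ((i + 2).factorial : k)⁻¹ • (LieAlgebra.ad k (lieAlg U hU) Z ^ i) ⁅Z, ⁅Z, X⁆⁆ := by
  have hZ := isNilpotent_coe U hU Z
  obtain ⟨m, hm⟩ := LieAlgebra.ad_nilpotent_of_nilpotent (R := ℚ) hZ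
  refine ⟨m, Subtype.ext ?_⟩
  have hinv : (((expEquiv U hU Z : GL (Fin n) k)⁻¹ : GL (Fin n) k) : Matrix (Fin n) (Fin n) k) =
      exp (-(Z : Matrix (Fin n) (Fin n) k)) := by
    have h1 := IsNilpotent.exp_mul_exp_neg_self hZ
    rw [← coe_expEquiv] at h1
    exact (Units.inv_eq_of_mul_eq_one_right h1)
  have hpow : ∀ (i : ℕ) (Y : lieAlg U hU),
      (LieAlgebra.ad ℚ _ (Z : Matrix (Fin n) (Fin n) k) ^ i) (Y : Matrix (Fin n) (Fin n) k) =
        ((LieAlgebra.ad k (lieAlg U hU) Z ^ i) Y : lieAlg U hU) := by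
    intro i Y
    induction i with
    | zero => rfl
    | succ i ih =>
      rw [pow_succ', Module.End.mul_apply, ih, pow_succ', Module.End.mul_apply]
      rfl
  have h := exp_mul_mul_exp_neg hZ (X : Matrix (Fin n) (Fin n) k) (m := m + 2)
    (pow_eq_zero_of_le (Nat.le_add_right m 2) hm)
  rw [← hinv, ← coe_expEquiv, sum_range_succ', sum_range_succ'] at h
  refine h.trans ?_
  simp only [hpow, pow_succ, Module.End.mul_apply, LieAlgebra.ad_apply]
  simp only [zero_add, pow_zero, Module.End.one_apply, Nat.factorial_zero, Nat.factorial_one,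
    Nat.cast_one, inv_one, one_smul]
  rw [add_comm, add_comm (∑ i ∈ range m, _), ← add_assoc]
  refine congrArg₂ (· + ·) rfl ?_
  rw [AddSubmonoidClass.coe_finsetSum]
  refine sum_congr rfl fun i _ => ?_
  rw [← Rat.cast_smul_eq_qsmul k, Rat.cast_inv, Rat.cast_natCast]
  exact congrArg _ (hpow i ⁅Z, ⁅Z, X⁆⁆)

theorem isAdjointFamily_Ad : IsAdjointFamily k fun u X => Ad U hU u X where
  map_add u X Y := map_add (Ad U hU u) X Y
  sub_mem u I X hX := by
    obtain ⟨Z, rfl⟩ := (expEquiv U hU).surjective u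
    obtain ⟨m, h⟩ := exists_Ad_expEquiv_eq U hU Z X
    have hZX := (LieSubmodule.mem_normalizer I X).mp hX Z
    rw [h, add_assoc, add_sub_cancel_left]
    refine add_mem hZX (sum_mem fun i _ => I.smul_mem _ ?_)
    exact ad_pow_mem I Z (I.lie_mem hZX) i
  exists_sub_mem Z := by
    refine ⟨expEquiv U hU Z, fun I X hX => ?_⟩
    obtain ⟨m, h⟩ := exists_Ad_expEquiv_eq U hU Z X
    have hZX := (LieSubmodule.mem_normalizer I _).mp ((LieSubmodule.mem_normalizer _ X).mp hX Z) Z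
    rw [h, sub_sub, add_sub_cancel_left]
    exact sum_mem fun i _ => I.smul_mem _ (ad_pow_mem I Z hZX i)

theorem isAdaptedChart_expEquiv :
    IsAdaptedChart k (fun u X => Ad U hU u X) (expEquiv U hU) where
  map_neg X := by
    have hX := isNilpotent_coe U hU X
    refine eq_inv_of_mul_eq_one_left (Subtype.ext (Units.ext ?_))
    have h := IsNilpotent.exp_neg_mul_exp_self hX
    simpa [coe_expEquiv] using h
  mul_mem I X Y hY := by
    set W := (expEquiv U hU).symm (expEquiv U hU X * expEquiv U hU Y) with hW
    have hWexp : exp (W : Matrix (Fin n) (Fin n) k) =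
        exp (X : Matrix (Fin n) (Fin n) k) * exp (Y : Matrix (Fin n) (Fin n) k) := by
      rw [← coe_expEquiv, hW, Equiv.apply_symm_apply, ← coe_expEquiv, ← coe_expEquiv]
      rfl
    have h := log_exp_mul_exp_sub_mem (lieAlg U hU).toSubmodule
      (I.toSubmodule.map (lieAlg U hU).toSubmodule.subtype)
      (coe_mem_strictlyUpper U hU X) (coe_mem_strictlyUpper U hU Y) (coe_mem_strictlyUpper U hU W)
      (fun t V hV hexp => ⟨hV, expEquiv U hU X * expEquiv U hU (t • Y),
        (expEquiv U hU X * expEquiv U hU (t • Y)).2, ?_⟩)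
      (fun V hV a ha => ?_) (fun V hV => ?_) hWexp
    · obtain ⟨a, ha, haW⟩ := h
      have : a = W - X - Y := Subtype.ext haW
      exact this ▸ ha
    · rw [hexp, Units.val_mul, coe_expEquiv, coe_expEquiv]
      rfl
    · obtain ⟨a, ha, rfl⟩ := ha
      exact ⟨⁅(⟨V, hV⟩ : lieAlg U hU), a⁆, I.lie_mem ha, rfl⟩
    · exact ⟨⁅(⟨V, hV⟩ : lieAlg U hU), Y⁆, (LieSubmodule.mem_normalizer I Y).mp hY _, rfl⟩
  exists_conj X := ⟨expEquiv U hU X, fun Y => (expMap_Ad U hU (expMap U hU X) Y).symm⟩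

theorem isAdaptedChart_ofAdd :
    IsAdaptedChart k (fun u X => Ad U hU u X)
      (Multiplicative.ofAdd : lieAlg U hU ≃ Multiplicative (lieAlg U hU)) where
  map_neg X := rfl
  mul_mem I X Y _ := by
    rw [← ofAdd_add, Equiv.symm_apply_apply, add_sub_cancel_left, sub_self]
    exact I.zero_mem
  exists_conj X := by
    refine ⟨1, fun Y => ?_⟩
    have h : Ad U hU 1 Y = Y := Subtype.ext (by
      change ((1 : GL (Fin n) k) : Matrix (Fin n) (Fin n) k) * _ *
        ((1⁻¹ : GL (Fin n) k) : Matrix (Fin n) (Fin n) k) = _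
      simp)
    rw [h, mul_comm, inv_mul_cancel_left]

theorem chartTraces_expEquiv :
    chartTraces (fun u X => Ad U hU u X) (expEquiv U hU) =
      chartTraces (fun u X => Ad U hU u X) Multiplicative.ofAdd :=
  have hA := isAdjointFamily_Ad U hU
  have he := isAdaptedChart_expEquiv U hU
  have he' := isAdaptedChart_ofAdd U hU
  (chartTraces_subset hA he he').antisymm (chartTraces_subset hA he' he)

theorem mem_traces_iff (φ : U → ℂ) :
    φ ∈ traces U ↔ φ ∘ expEquiv U hU ∈ chartTraces (fun u X => Ad U hU u X) (expEquiv U hU) := by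
  refine and_congr (by simp [Function.comp_assoc]) (and_congr ?_ ?_)
  · refine forall_congr' fun u => (expEquiv U hU).surjective.forall.trans
      (forall_congr' fun X => ?_)
    rw [Function.comp_apply, Function.comp_apply, MulAut.conj_apply]
    exact iff_of_eq (congrArg (fun v => φ v = _) (expMap_Ad U hU u X).symm)
  · rw [Function.comp_apply, (isAdaptedChart_expEquiv U hU).map_zero]

theorem mem_adTraces_iff (f : Multiplicative (lieAlg U hU) → ℂ) :
    f ∈ adTraces U hU ↔
      f ∘ Multiplicative.ofAdd ∈ chartTraces (fun u X => Ad U hU u X) Multiplicative.ofAdd :=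
  Iff.rfl

theorem mem_traces_iff_compExp_mem_adTraces (φ : U → ℂ) :
    φ ∈ traces U ↔ compExp U hU φ ∈ adTraces U hU := by
  rw [mem_traces_iff U hU, mem_adTraces_iff, chartTraces_expEquiv]
  rfl

end UnipotentGroup

end UnipotentTraces

theorem mainTheorem6 {k : Type*} [Field k] [CharZero k] {n : ℕ}
    (U : Subgroup (Matrix.GeneralLinearGroup (Fin n) k))
    (hU : UnipotentTraces.IsUnipotentAlgebraic U) :
    (∀ φ : U → ℂ,
      φ ∈ UnipotentTraces.traces U ↔
        UnipotentTraces.compExp U hU φ ∈ UnipotentTraces.adTraces U hU) ∧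
    Set.BijOn (UnipotentTraces.compExp U hU)
      (UnipotentTraces.traces U) (UnipotentTraces.adTraces U hU) := by
  have hmem := UnipotentTraces.mem_traces_iff_compExp_mem_adTraces U hU
  refine ⟨hmem, fun φ hφ => (hmem φ).mp hφ, fun φ _ ψ _ h => ?_, fun f hf => ?_⟩
  · funext u
    obtain ⟨X, rfl⟩ := (UnipotentTraces.expEquiv U hU).surjective u
    exact congrFun h (Multiplicative.ofAdd X)
  · have hcomp : UnipotentTraces.compExp U hU
        (fun u => f (Multiplicative.ofAdd ((UnipotentTraces.expEquiv U hU).symm u))) = f := by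
      funext X
      exact congrArg (fun Y => f (Multiplicative.ofAdd Y))
        ((UnipotentTraces.expEquiv U hU).symm_apply_apply X.toAdd)
    exact ⟨_, (hmem _).mpr (hcomp.symm ▸ hf), hcomp⟩
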